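/- **Setting.** Let $X$ be a real Banach space, $\Omega\subset X$ open, and $Y$ an infinite-dimensional real vector space. For $x\in\Omega$ let $Q(x,\cdot)$ be a positive definite quadratic form on $Y$, and let $G(x,\cdot)$ be a quadratic form defined on a linear subspace $H(x)\subset Y$ (put $G(x,\cdot)=+\infty$ outside $H(x)$) that is dense for the norm $Q(x,\cdot)^{1/2}$. Let $B(x,\cdot,\cdot)$ and $\Gamma(x,\cdot,\cdot)$ be the associated symmetric bilinear forms, and $\mathcal R(x,u)=G(x,u)/Q(x,u)$ for $u\in Y\setminus\{0\}$. A subscript $x$ denotes the Fréchet derivative in the first variable, with values in $X^*$ with its dual norm. Assume that for every $x\in\Omega$ there is a bounded function $\theta>0$ on a neighbourhood of $x$ in $\Omega$ such that, with $N(y,\cdot)=[G(y,\cdot)+\theta(y)Q(y,\cdot)]^{1/2}$: * for all $y$ near $x$, $N(y,\cdot)$ is a Hilbert norm on $H(y)$, and for some $C\ge1$, $C^{-1}N(y,\cdot)\le N(x,\cdot)\le C\,N(y,\cdot)$; in particular $H(y)=H(x)=:H$; * if $x_n\to x$ in $\Omega$, $u_n\in H$ and $\sup_nN(x_n,u_n)<\infty$,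 then there is $u\in H$ such that, along a common subsequence, $Q(x_n,u_n-u)\to0$ and $\Gamma(x_n,u_n,v)\to\Gamma(x,u,v)$ for all $v\in H$; * $Q(\cdot,u)$ and $G(\cdot,v)$ are Fréchet differentiable at $x$ for $u\in Y$, $v\in H$; * if $x_n\to x$ in $\Omega$, $u_n,u\in Y$ and $Q(x_n,u_n-u)\to0$, then $Q(x_n,u_n)\to Q(x,u)$ and $Q_x(x_n,u_n)\to Q_x(x,u)$; if $x_n\to x$ in $\Omega$, $v_n,v\in H$ and $N(x_n,v_n-v)\to0$, then $G(x_n,v_n)\to G(x,v)$ and $G_x(x_n,v_n)\to G_x(x,v)$; * for some $C_0>0$, all $y$ near $x$ and all $u,v\in H$, both $\|B_x(y,u,v)\|_{X^*}$ and $\|\Gamma_x(y,u,v)\|_{X^*}$ are at most $C_0N(y,u)N(y,v)$. Let $L(x)$ be the self-adjoint operator given by $\Gamma(x,u,v)=B(x,L(x)u,v)$ for all $v\in H$, let $\lambda_1(x)\le\lambda_2(x)\le\cdots\to+\infty$ be its eigenvalues counted with multiplicity, and let $E_k(x)=\{u : L(x)u=\lambda_k(x)u\}$. Let $\mathrm{sc}:\Omega\to(0,+\infty)$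 be of class $\mathcal C^1$ (Fréchet) and $\bar\lambda_k=\mathrm{sc}\,\lambda_k$. For a function $\mathfrak F$ on $\Omega$ with right directional derivatives $\mathfrak F'_r(x;h)$ at $x$ in all directions $h$, let $$\partial^-\mathfrak F(x)=\{\zeta\in X^*:\langle\zeta,h\rangle\le\mathfrak F_r'(x;h)\ \forall h\},\qquad \partial^+\mathfrak F(x)=\{\zeta\in X^*:\langle\zeta,h\rangle\ge\mathfrak F_r'(x;h)\ \forall h\}.$$ The Clarke sets $\partial_C^-\mathfrak F(x)$ and $\partial_C^+\mathfrak F(x)$ are defined likewise, with $\mathfrak F_r'(x;h)$ replaced by the $\limsup$, respectively the $\liminf$, of $(\mathfrak F(y+th)-\mathfrak F(y))/t$ as $y\to x$, $t\downarrow0$; and $x$ is *critical* for $\mathfrak F$ if $0\in\partial_C^-\mathfrak F(x)\cup\partial_C^+\mathfrak F(x)$. **Theorem.** Let $x\in\Omega$, and let $\phi_j\in E_{k_j}(x)\setminus\{0\}$, $k_j\ge 1$, $\delta_j\in\mathbb R$ $(1\le j\le l)$ satisfy $$\sum_{j=1}^l\delta_j\,\mathcal R_x(x,\phi_j)+\frac{\mathrm{sc}_x(x)}{\mathrm{sc}(x)}\sum_{j=1}^l\delta_j\lambda_{k_j}(x)=0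 .$$ Then there are $N\ge1$ and $d_1^\pm,\dots,d_N^\pm\in\mathbb R$ such that for every $F^\pm\in\mathcal C^1(\mathbb R^N,\mathbb R)$ with $$\partial_iF^\pm(\bar\lambda_1(x),\dots,\bar\lambda_N(x))=d_i^\pm\qquad(1\le i\le N),$$ the function $\mathfrak F^\pm=F^\pm\circ(\bar\lambda_1,\dots,\bar\lambda_N)$ has right directional derivatives at $x$ in all directions and satisfies $$0\in\partial^\pm\mathfrak F^\pm(x).$$ In particular $x$ is critical for $\mathfrak F^+$ and for $\mathfrak F^-$. Moreover, the coefficients can be chosen so that: * $d_i^+>0$ or $d_i^-<0$ only if $i=1$ or $\lambda_{i-1}(x)<\lambda_i(x)$, and $d_i^+<0$ or $d_i^->0$ only if $\lambda_i(x)<\lambda_{i+1}(x)$; * for every $\mu\in\mathbb R$, $\displaystyle\sum_{i\le N,\ \lambda_i(x)=\mu}d_i^\pm=\sum_{j:\ \lambda_{k_j}(x)=\mu}\delta_j$, and the $d_i^+$ (or the $d_i^-$) with $i\le N$, $\lambda_i(x)=\mu$ all vanish only if $\displaystyle\sum_{j:\ \lambda_{k_j}(x)=\mu}\delta_j\,\frac{B(x,\phi_j,u)^2}{Q(x,\phi_j)}=0$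 for all $u\in Y$. -/

import Mathlib

open Filter Topology

noncomputable section

/-! ### Nonsmooth analysis on a real normed space

Functions are defined on the whole space for convenience; every notion below is local at `x`, so
only the values on a neighbourhood of `x` matter. -/

/-- `f` has right directional derivative `ℓ` at `x` in the direction `h`. -/
def HasRightDirDeriv {X : Type*} [NormedAddCommGroup X] [NormedSpace ℝ X]
    (f : X → ℝ) (x h : X) (ℓ : ℝ) : Prop :=
  Tendsto (fun t : ℝ => (f (x + t • h) - f x) / t) (𝓝[>] 0) (𝓝 ℓ)

/-- The classical subdifferential `∂⁻ f(x)`. Membership includes the existence of the right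
directional derivative in every direction, without which `∂⁻ f(x)` is not defined. -/
def subdifferential {X : Type*} [NormedAddCommGroup X] [NormedSpace ℝ X]
    (f : X → ℝ) (x : X) : Set (X →L[ℝ] ℝ) :=
  {ζ | ∀ h : X, ∃ ℓ : ℝ, HasRightDirDeriv f x h ℓ ∧ ζ h ≤ ℓ}

/-- The classical superdifferential `∂⁺ f(x)`; same convention. -/
def superdifferential {X : Type*} [NormedAddCommGroup X] [NormedSpace ℝ X]
    (f : X → ℝ) (x : X) : Set (X →L[ℝ] ℝ) :=
  {ζ | ∀ h : X, ∃ ℓ : ℝ, HasRightDirDeriv f x h ℓ ∧ ℓ ≤ ζ h}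

/-- Clarke's generalized upper directional derivative, as an extended real:
the `limsup` of `(f (y + t h) - f y) / t` as `y → x` and `t ↓ 0`. -/
def clarkeUpper {X : Type*} [NormedAddCommGroup X] [NormedSpace ℝ X]
    (f : X → ℝ) (x h : X) : EReal :=
  limsup (fun p : X × ℝ => (((f (p.1 + p.2 • h) - f p.1) / p.2 : ℝ) : EReal))
    (𝓝 x ×ˢ 𝓝[>] (0 : ℝ))

/-- Clarke's generalized lower directional derivative, as an extended real. -/
def clarkeLower {X : Type*} [NormedAddCommGroup X] [NormedSpace ℝ X]
    (f : X → ℝ) (x h : X) : EReal :=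
  liminf (fun p : X × ℝ => (((f (p.1 + p.2 • h) - f p.1) / p.2 : ℝ) : EReal))
    (𝓝 x ×ˢ 𝓝[>] (0 : ℝ))

/-- The Clarke subdifferential. -/
def clarkeSubdifferential {X : Type*} [NormedAddCommGroup X] [NormedSpace ℝ X]
    (f : X → ℝ) (x : X) : Set (X →L[ℝ] ℝ) :=
  {ζ | ∀ h : X, ((ζ h : ℝ) : EReal) ≤ clarkeUpper f x h}

/-- The Clarke superdifferential. -/
def clarkeSuperdifferential {X : Type*} [NormedAddCommGroup X] [NormedSpace ℝ X]
    (f : X → ℝ) (x : X) : Set (X →L[ℝ] ℝ) :=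
  {ζ | ∀ h : X, clarkeLower f x h ≤ ((ζ h : ℝ) : EReal)}

/-- `x` is critical for `f`. -/
def IsCriticalFor {X : Type*} [NormedAddCommGroup X] [NormedSpace ℝ X]
    (f : X → ℝ) (x : X) : Prop :=
  (0 : X →L[ℝ] ℝ) ∈ clarkeSubdifferential f x ∪ clarkeSuperdifferential f x

/-! ### Families of Rayleigh quotients -/

/-- The data of a family of Rayleigh quotients: quadratic forms `Q(x, ·)` on `Y` and
`G(x, ·)` with domain the linear subspace `H(x)` of `Y` (outside of which `G(x, ·) = +∞`). -/
structure RayleighFamily (X Y : Type*) [AddCommGroup Y] [Module ℝ Y] where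
  /-- the form in the denominator -/
  Q : X → QuadraticForm ℝ Y
  /-- the domain of the form in the numerator -/
  H : X → Submodule ℝ Y
  /-- the form in the numerator, on its domain -/
  G : ∀ x : X, QuadraticForm ℝ (H x)

namespace RayleighFamily

open Classical in
/-- The real number `G(x, u)` for `u ∈ H(x)`. (For `u ∉ H(x)` the value is `+∞` on paper; it is
replaced by a junk `0` that is never used.) -/
def g {X Y : Type*} [AddCommGroup Y] [Module ℝ Y] (D : RayleighFamily X Y) (x : X) (u : Y) : ℝ :=
  if hu : u ∈ D.H x then D.G x ⟨u, hu⟩ else 0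

/-- The symmetric bilinear form of `Q(x, ·)`: `B(u, v) = (Q(u+v) - Q(u) - Q(v)) / 2`. -/
def B {X Y : Type*} [AddCommGroup Y] [Module ℝ Y] (D : RayleighFamily X Y) (x : X) (u v : Y) : ℝ :=
  (D.Q x (u + v) - D.Q x u - D.Q x v) / 2

/-- The symmetric bilinear form of `G(x, ·)`, for `u, v ∈ H(x)`. -/
def Γ {X Y : Type*} [AddCommGroup Y] [Module ℝ Y] (D : RayleighFamily X Y) (x : X) (u v : Y) : ℝ :=
  (D.g x (u + v) - D.g x u - D.g x v) / 2

/-- `N(x, u) = (G(x, u) + θ Q(x, u)) ^ (1/2)` for `u ∈ H(x)`. -/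
def N {X Y : Type*} [AddCommGroup Y] [Module ℝ Y] (D : RayleighFamily X Y) (θ : ℝ) (x : X)
    (u : Y) : ℝ :=
  Real.sqrt (D.g x u + θ * D.Q x u)

/-- The Rayleigh quotient `R(x, u) = G(x, u) / Q(x, u)` of a nonzero `u ∈ H(x)`. -/
def rayleigh {X Y : Type*} [AddCommGroup Y] [Module ℝ Y] (D : RayleighFamily X Y) (x : X)
    (u : Y) : ℝ :=
  D.g x u / D.Q x u

/-- `N(x, ·)` is a Hilbert norm on `H(x)`: it comes from the scalar product `Γ + θ B`, it is
positive definite, and it is complete. -/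
structure IsHilbertNorm {X Y : Type*} [AddCommGroup Y] [Module ℝ Y] (D : RayleighFamily X Y)
    (θ : ℝ) (x : X) : Prop where
  pos : ∀ u ∈ D.H x, u ≠ 0 → 0 < D.g x u + θ * D.Q x u
  complete : ∀ u : ℕ → Y, (∀ n, u n ∈ D.H x) →
    (∀ ε : ℝ, 0 < ε → ∃ n₀, ∀ m ≥ n₀, ∀ n ≥ n₀, D.N θ x (u m - u n) < ε) →
    ∃ v ∈ D.H x, Tendsto (fun n => D.N θ x (u n - v)) atTop (𝓝 0)

/-- The standing assumptions at a point `x` of the open set `Ω`, with `θ` the function that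
enters the norms `N(y, ·) = (G(y, ·) + θ(y) Q(y, ·)) ^ (1/2)` for `y` near `x`. -/
structure StandingAt {X Y : Type*} [NormedAddCommGroup X] [NormedSpace ℝ X]
    [AddCommGroup Y] [Module ℝ Y] (D : RayleighFamily X Y) (Ω : Set X) (θ : X → ℝ) (x : X) :
    Prop where
  /-- (A) `Q(x, ·)` is positive definite -/
  posDef : (D.Q x).PosDef
  /-- (A) `H(x)` is dense in `Y` for the norm `Q(x, ·) ^ (1/2)` -/
  dense : ∀ u : Y, ∀ ε : ℝ, 0 < ε → ∃ v ∈ D.H x, D.Q x (u - v) < ε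
  /-- (B) `θ` is positive near `x` -/
  theta_pos : ∀ᶠ y in 𝓝 x, 0 < θ y
  /-- (B) `θ` is bounded near `x` -/
  theta_bdd : ∃ M : ℝ, ∀ᶠ y in 𝓝 x, θ y ≤ M
  /-- (B) `N(y, ·)` is a Hilbert norm on `H(y)` for `y` near `x` -/
  hilbert : ∀ᶠ y in 𝓝 x, D.IsHilbertNorm (θ y) y
  /-- (C) the norms `N(y, ·)`, with value `+∞` outside `H(y)`, are equivalent to `N(x, ·)`
  uniformly for `y` near `x`; in particular the domains agree -/
  equiv : ∃ C : ℝ, 1 ≤ C ∧ ∀ᶠ y in 𝓝 x, D.H y = D.H x ∧ ∀ u ∈ D.H x,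
    C⁻¹ * D.N (θ y) y u ≤ D.N (θ x) x u ∧ D.N (θ x) x u ≤ C * D.N (θ y) y u
  /-- (D) compactness -/
  compact : ∀ (y : ℕ → X) (u : ℕ → Y), (∀ n, y n ∈ Ω) → Tendsto y atTop (𝓝 x) →
    (∀ n, u n ∈ D.H x) → (∃ M : ℝ, ∀ n, D.N (θ (y n)) (y n) (u n) ≤ M) →
    ∃ v ∈ D.H x, ∃ s : ℕ → ℕ, StrictMono s ∧
      Tendsto (fun n => D.Q (y (s n)) (u (s n) - v)) atTop (𝓝 0) ∧
      ∀ w ∈ D.H x, Tendsto (fun n => D.Γ (y (s n)) (u (s n)) w) atTop (𝓝 (D.Γ x v w))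
  /-- (E) Fréchet differentiability of `Q(·, u)` at `x` -/
  diff_Q : ∀ u : Y, DifferentiableAt ℝ (fun y => D.Q y u) x
  /-- (E) Fréchet differentiability of `G(·, v)` at `x` -/
  diff_G : ∀ v ∈ D.H x, DifferentiableAt ℝ (fun y => D.g y v) x
  /-- (F) continuity of `Q` and of its derivative (for the dual norm) -/
  cont_Q : ∀ (y : ℕ → X) (u : ℕ → Y) (v : Y), (∀ n, y n ∈ Ω) → Tendsto y atTop (𝓝 x) →
    Tendsto (fun n => D.Q (y n) (u n - v)) atTop (𝓝 0) →
    Tendsto (fun n => D.Q (y n) (u n)) atTop (𝓝 (D.Q x v)) ∧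
    Tendsto (fun n => fderiv ℝ (fun z => D.Q z (u n)) (y n)) atTop
      (𝓝 (fderiv ℝ (fun z => D.Q z v) x))
  /-- (F) continuity of `G` and of its derivative (for the dual norm) -/
  cont_G : ∀ (y : ℕ → X) (u : ℕ → Y), ∀ v ∈ D.H x, (∀ n, y n ∈ Ω) → Tendsto y atTop (𝓝 x) →
    (∀ n, u n ∈ D.H x) → Tendsto (fun n => D.N (θ (y n)) (y n) (u n - v)) atTop (𝓝 0) →
    Tendsto (fun n => D.g (y n) (u n)) atTop (𝓝 (D.g x v)) ∧
    Tendsto (fun n => fderiv ℝ (fun z => D.g z (u n)) (y n)) atTop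
      (𝓝 (fderiv ℝ (fun z => D.g z v) x))
  /-- (G) bounds on the derivatives of the bilinear forms. (The bound on `B` is void for vectors
  outside the domain, where `N = +∞`.) -/
  deriv_bound : ∃ C₀ : ℝ, 0 < C₀ ∧ ∀ᶠ y in 𝓝 x, ∀ u ∈ D.H y, ∀ v ∈ D.H y,
    ‖fderiv ℝ (fun z => D.B z u v) y‖ ≤ C₀ * D.N (θ y) y u * D.N (θ y) y v ∧
    ‖fderiv ℝ (fun z => D.Γ z u v) y‖ ≤ C₀ * D.N (θ y) y u * D.N (θ y) y v

/-- The standing assumptions on a family of Rayleigh quotients over `Ω`. -/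
def Standing {X Y : Type*} [NormedAddCommGroup X] [NormedSpace ℝ X]
    [AddCommGroup Y] [Module ℝ Y] (D : RayleighFamily X Y) (Ω : Set X) : Prop :=
  ∀ x ∈ Ω, ∃ θ : X → ℝ, D.StandingAt Ω θ x

/-- The eigenspace at `μ` of the self-adjoint operator `L(x)` associated with the forms
`G(x, ·)` and `Q(x, ·)`. Since `L(x) u = γ` means `Γ(x, u, v) = B(x, γ, v)` for all `v ∈ H(x)`,
it is the space of all `u ∈ H(x)` with `Γ(x, u, v) = μ B(x, u, v)` for all `v ∈ H(x)`
(see `mem_eigenspace`). -/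
def eigenspace {X Y : Type*} [AddCommGroup Y] [Module ℝ Y] (D : RayleighFamily X Y) (x : X)
    (μ : ℝ) : Submodule ℝ Y :=
  (LinearMap.ker ((D.G x).polarBilin
    - μ • ((D.Q x).comp (D.H x).subtype).polarBilin)).map (D.H x).subtype

theorem mem_eigenspace {X Y : Type*} [AddCommGroup Y] [Module ℝ Y] (D : RayleighFamily X Y)
    (x : X) (μ : ℝ) (u : Y) :
    u ∈ D.eigenspace x μ ↔ u ∈ D.H x ∧ ∀ v ∈ D.H x, D.Γ x u v = μ * D.B x u v := by
  have key : ∀ (hu : u ∈ D.H x) (v : Y) (hv : v ∈ D.H x),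
      ((D.G x).polarBilin - μ • ((D.Q x).comp (D.H x).subtype).polarBilin) ⟨u, hu⟩ ⟨v, hv⟩
        = 2 * (D.Γ x u v - μ * D.B x u v) := by
    intro hu v hv
    simp only [Γ, B, g, hu, hv, add_mem hu hv, dif_pos, LinearMap.sub_apply, LinearMap.smul_apply,
      QuadraticMap.polarBilin_apply_apply, QuadraticMap.polar, QuadraticMap.comp_apply,
      Submodule.subtype_apply, smul_eq_mul, AddMemClass.mk_add_mk]
    ring
  constructor
  · rintro ⟨⟨w, hw⟩, hker, rfl⟩
    refine ⟨hw, fun v hv => ?_⟩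
    have h := key hw v hv
    have h0 := LinearMap.congr_fun (LinearMap.mem_ker.mp hker) ⟨v, hv⟩
    rw [LinearMap.zero_apply] at h0
    have : 2 * (D.Γ x w v - μ * D.B x w v) = 0 := h.symm.trans h0
    simp only [Submodule.subtype_apply]
    linarith
  · rintro ⟨hu, h⟩
    refine ⟨⟨u, hu⟩, ?_, rfl⟩
    refine LinearMap.mem_ker.mpr (LinearMap.ext fun v => ?_)
    have := key hu v.1 v.2
    rw [h v.1 v.2] at this
    simpa using this

/-- The `k`-th eigenvalue `λ_k(x)` of `L(x)`, `k ≥ 1`, counted in increasing order with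
multiplicity: the least `t` such that the eigenvectors with eigenvalue at most `t` span a space
of dimension at least `k`. -/
def eigenvalue {X Y : Type*} [AddCommGroup Y] [Module ℝ Y] (D : RayleighFamily X Y) (k : ℕ)
    (x : X) : ℝ :=
  sInf {t : ℝ | (k : Cardinal) ≤ Module.rank ℝ ↥(⨆ (s : ℝ) (_ : s ≤ t), D.eigenspace x s)}

/-- The eigenspace `E_k(x)` of the `k`-th eigenvalue. -/
def E {X Y : Type*} [AddCommGroup Y] [Module ℝ Y] (D : RayleighFamily X Y) (k : ℕ) (x : X) :
    Submodule ℝ Y :=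
  D.eigenspace x (D.eigenvalue k x)

end RayleighFamily

end

/-!
Along a ray `t ↦ x + t h` the forms `G`, `Q` restricted to the fixed domain `H = H(x)` are
differentiable from the right, with increments of size `O(t N(x, u) N(x, v))`. The compactness
assumption at a single point already gives the spectral theorem
(`CompactPair.exists_eigenSystem`, by successive minimization of the Rayleigh quotient) and hence
the Courant–Fischer principle (`EigenSystem.exists_ge`, `EigenSystem.exists_le`).

Let `μ` be an eigenvalue at `x` and `A_h = G_x h - μ Q_x h`. The first eigenvalue of the block of
`μ` has right derivative `inf A_h` and the last one `sup A_h`, over the normalized vectors of the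
eigenspace of `μ`; every eigenvalue is Lipschitz along the ray. Both one-sided bounds
(`PerturbedPair.eventually_le`, `PerturbedPair.eventually_ge`) are proved by contradiction: if a
bound fails along `t_n → 0`, Courant–Fischer at time `t_n` yields a normalized test vector for
which `((G - μ Q)(x + t_n h, w_n) - (G - μ Q)(x, w_n)) / t_n` is on the wrong side; the `w_n`
converge strongly to an eigenvector at `x`, and there the value of `A_h` contradicts the choice of
the constant. No regularity of the eigenvectors in `t` is needed.

Since `A_h(φ) / Q(φ)` is the derivative of the Rayleigh quotient of an eigenvector `φ`, it lies
between the derivatives of the first and of the last eigenvalue of its block. The coefficients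
`d⁺` send `δ_j` to the first index of the block of `λ_{k_j}` if `δ_j ≥ 0` and to the last index
otherwise; `d⁻` does the opposite. The Euler–Lagrange equation then says exactly that the right
derivative of `F⁺ ∘ (sc λ)` is `≤ 0`, and that of `F⁻ ∘ (sc λ)` is `≥ 0`, in every direction
(`RayleighFamily.Standing.hasRightDirDeriv_comp_eigenvalue`). If all coefficients of a block
vanish, either its ends differ and all `δ_j` of the block are zero, or the eigenvalue is simple and
the quadratic form of the block is the total weight times a fixed square
(`RayleighFamily.Standing.weights_on_block`).
-/

/-! ### Pairs of symmetric forms with a compact embedding -/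

section BilinForm

variable {V : Type*} [AddCommGroup V] [Module ℝ V]

theorem bilin_sum_left (a : LinearMap.BilinForm ℝ V) (s : Finset ℕ) (c : ℕ → ℝ) (e : ℕ → V)
    (v : V) : a (∑ i ∈ s, c i • e i) v = ∑ i ∈ s, c i * a (e i) v := by
  simp [map_sum, LinearMap.sum_apply]

theorem bilin_sum_right (a : LinearMap.BilinForm ℝ V) (s : Finset ℕ) (c : ℕ → ℝ) (e : ℕ → V)
    (v : V) : a v (∑ i ∈ s, c i • e i) = ∑ i ∈ s, c i * a v (e i) := by
  simp [map_sum]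

theorem bilin_add_smul_self {a : LinearMap.BilinForm ℝ V} (ha : ∀ u v, a u v = a v u)
    (u w : V) (s : ℝ) :
    a (u + s • w) (u + s • w) = a u u + 2 * s * a u w + s ^ 2 * a w w := by
  simp only [map_add, LinearMap.add_apply, map_smul, LinearMap.smul_apply, smul_eq_mul, ha w u]
  ring

theorem bilin_sub_self {a : LinearMap.BilinForm ℝ V} (ha : ∀ u v, a u v = a v u)
    (u w : V) : a (u - w) (u - w) = a u u - 2 * a u w + a w w := by
  simp only [map_sub, LinearMap.sub_apply, ha w u]
  ring

theorem bilin_smul_self (a : LinearMap.BilinForm ℝ V) (s : ℝ) (u : V) :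
    a (s • u) (s • u) = s ^ 2 * a u u := by
  simp only [map_smul, LinearMap.smul_apply, smul_eq_mul]
  ring

/-- First variation: a symmetric form that is nonnegative on the line `u + ℝ w` and vanishes
at `u` is orthogonal to `w` at `u`. -/
theorem bilin_eq_zero_of_nonneg_on_line {r : LinearMap.BilinForm ℝ V}
    (hr : ∀ u v, r u v = r v u) {u w : V} (h : ∀ s : ℝ, 0 ≤ r (u + s • w) (u + s • w))
    (hu : r u u = 0) : r u w = 0 := by
  have h1 : ∀ s : ℝ, 0 ≤ r w w * (s * s) + (2 * r u w) * s + 0 := by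
    intro s
    have := h s
    rw [bilin_add_smul_self hr, hu] at this
    linarith
  have h2 := discrim_le_zero h1
  rw [discrim] at h2
  nlinarith [sq_nonneg (r u w)]

theorem bilin_sum_orthonormal_left {b : LinearMap.BilinForm ℝ V} {e : ℕ → V} {k : ℕ}
    (ho : ∀ i < k, ∀ j < k, b (e i) (e j) = if i = j then 1 else 0) (c : ℕ → ℝ) {j : ℕ}
    (hj : j < k) : b (∑ i ∈ Finset.range k, c i • e i) (e j) = c j := by
  rw [bilin_sum_left, Finset.sum_congr rfl
    (g := fun i => if i = j then c i else 0)]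
  · simp [hj]
  · intro i hi
    rw [ho i (Finset.mem_range.mp hi) j hj]
    simp

theorem bilin_sum_orthonormal_self {b : LinearMap.BilinForm ℝ V} {e : ℕ → V} {k : ℕ}
    (ho : ∀ i < k, ∀ j < k, b (e i) (e j) = if i = j then 1 else 0) (c : ℕ → ℝ) :
    b (∑ i ∈ Finset.range k, c i • e i) (∑ i ∈ Finset.range k, c i • e i)
      = ∑ i ∈ Finset.range k, c i ^ 2 := by
  rw [bilin_sum_right]
  refine Finset.sum_congr rfl fun i hi => ?_
  rw [bilin_sum_orthonormal_left ho c (Finset.mem_range.mp hi)]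
  ring

/-- Subtracting the Fourier sum makes a vector orthogonal to an orthonormal family. -/
theorem bilin_sub_fourier {b : LinearMap.BilinForm ℝ V} (hb : ∀ u v, b u v = b v u) {e : ℕ → V}
    {k : ℕ} (ho : ∀ i < k, ∀ j < k, b (e i) (e j) = if i = j then 1 else 0) (u : V) {j : ℕ}
    (hj : j < k) : b (e j) (u - ∑ i ∈ Finset.range k, b (e i) u • e i) = 0 := by
  rw [hb, map_sub, LinearMap.sub_apply, bilin_sum_orthonormal_left ho _ hj, hb u, sub_self]

/-- In infinite dimension finitely many orthogonality conditions have a nonzero solution. -/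
theorem exists_ne_zero_orthogonal (hV : ¬ FiniteDimensional ℝ V) (b : LinearMap.BilinForm ℝ V)
    {t : Set V} (ht : t.Finite) : ∃ u : V, u ≠ 0 ∧ ∀ v ∈ t, b v u = 0 := by
  by_contra! hcon
  have : Finite t := ht
  let T : V →ₗ[ℝ] (t → ℝ) := LinearMap.pi fun v => b v.1
  refine hV (Module.Finite.of_injective T ?_)
  rw [← LinearMap.ker_eq_bot, LinearMap.ker_eq_bot']
  intro u hu
  by_contra hne
  obtain ⟨v, hv, hvu⟩ := hcon u hne
  exact hvu (congrFun hu ⟨v, hv⟩)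

/-- A linear map to a space of smaller dimension vanishes at some unit coordinate vector. -/
theorem exists_unit_mem_ker {U : Type*} [AddCommGroup U] [Module ℝ U] [FiniteDimensional ℝ U]
    {m : ℕ} (T : (Fin m → ℝ) →ₗ[ℝ] U) (hU : Module.finrank ℝ U < m) :
    ∃ c : ℕ → ℝ, ∑ i ∈ Finset.range m, c i ^ 2 = 1 ∧ T (fun i : Fin m => c i) = 0 := by
  obtain ⟨c, hc, hc0⟩ := Submodule.exists_mem_ne_zero_of_ne_bot
    (LinearMap.ker_ne_bot_of_finrank_lt (f := T) (by simpa using hU))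
  have hsum : 0 < ∑ i, c i ^ 2 := by
    obtain ⟨i, hi⟩ := Function.ne_iff.mp hc0
    exact Finset.sum_pos' (fun i _ => sq_nonneg _) ⟨i, Finset.mem_univ _, by
      have : c i ≠ 0 := hi
      positivity⟩
  refine ⟨fun i => if hi : i < m then (Real.sqrt (∑ i, c i ^ 2))⁻¹ * c ⟨i, hi⟩ else 0, ?_, ?_⟩
  · rw [Finset.sum_range]
    simp only [Fin.is_lt, dif_pos, Fin.eta, mul_pow, inv_pow, Real.sq_sqrt hsum.le]
    rw [← Finset.mul_sum, inv_mul_cancel₀ hsum.ne']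
  · have : (fun i : Fin m => if hi : (i : ℕ) < m then (Real.sqrt (∑ i, c i ^ 2))⁻¹ * c ⟨i, hi⟩
        else 0) = (Real.sqrt (∑ i, c i ^ 2))⁻¹ • c := by
      ext i
      simp
    rw [this, map_smul, LinearMap.mem_ker.mp hc, smul_zero]

/-- Symmetric forms `a`, `b` on a real vector space, `b` positive definite and `a + θ b`
nonnegative, such that every sequence bounded for `a + θ b` has a subsequence that converges
strongly for `b` and weakly for `a`. -/
structure CompactPair (a b : LinearMap.BilinForm ℝ V) (θ : ℝ) : Prop where
  symm_a : ∀ u v, a u v = a v u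
  symm_b : ∀ u v, b u v = b v u
  pos : ∀ u, u ≠ 0 → 0 < b u u
  nonneg : ∀ u, 0 ≤ a u u + θ * b u u
  compact : ∀ (u : ℕ → V) (M : ℝ), (∀ n, a (u n) (u n) + θ * b (u n) (u n) ≤ M) →
    ∃ v, ∃ s : ℕ → ℕ, StrictMono s ∧
      Tendsto (fun n => b (u (s n) - v) (u (s n) - v)) atTop (𝓝 0) ∧
      ∀ w, Tendsto (fun n => a (u (s n)) w) atTop (𝓝 (a v w))

namespace CompactPair

variable {a b : LinearMap.BilinForm ℝ V} {θ : ℝ}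

theorem b_nonneg (h : CompactPair a b θ) (u : V) : 0 ≤ b u u := by
  rcases eq_or_ne u 0 with rfl | hu
  · simp
  · exact (h.pos u hu).le

theorem eq_zero_of_b_nonpos (h : CompactPair a b θ) {u : V} (hu : b u u ≤ 0) : u = 0 := by
  by_contra hne
  exact absurd (h.pos u hne) (not_lt.mpr hu)

/-- `b`-strong convergence implies weak convergence for `b`. -/
theorem tendsto_b (h : CompactPair a b θ) {u : ℕ → V} {v : V}
    (hu : Tendsto (fun n => b (u n - v) (u n - v)) atTop (𝓝 0)) (w : V) :
    Tendsto (fun n => b (u n) w) atTop (𝓝 (b v w)) := by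
  have h1 : Tendsto (fun n => b (u n - v) w) atTop (𝓝 0) := by
    have h2 : Tendsto (fun n => Real.sqrt (b (u n - v) (u n - v) * b w w)) atTop (𝓝 0) := by
      have := (hu.mul_const (b w w)).sqrt
      simpa using this
    refine squeeze_zero_norm (fun n => ?_) h2
    rw [Real.norm_eq_abs]
    exact Real.abs_le_sqrt
      (LinearMap.BilinForm.apply_sq_le_of_symm b h.b_nonneg ⟨fun u v => h.symm_b u v⟩ _ _)
  have h3 := h1.add_const (b v w)
  simpa using h3

theorem tendsto_b_self (h : CompactPair a b θ) {u : ℕ → V} {v : V}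
    (hu : Tendsto (fun n => b (u n - v) (u n - v)) atTop (𝓝 0)) :
    Tendsto (fun n => b (u n) (u n)) atTop (𝓝 (b v v)) := by
  have h1 := (hu.add ((h.tendsto_b hu v).const_mul 2)).sub_const (b v v)
  refine (h1.congr fun n => ?_).trans_eq (by congr 1; ring)
  rw [bilin_sub_self h.symm_b]
  ring

/-- Lower semicontinuity of `a` along the convergence given by `CompactPair.compact`. -/
theorem a_le_of_eventually_le (h : CompactPair a b θ) {u : ℕ → V} {v : V}
    (hu : Tendsto (fun n => b (u n - v) (u n - v)) atTop (𝓝 0))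
    (hw : Tendsto (fun n => a (u n) v) atTop (𝓝 (a v v))) {m : ℕ → ℝ} {μ : ℝ}
    (hm : Tendsto m atTop (𝓝 μ)) (hum : ∀ᶠ n in atTop, a (u n) (u n) ≤ m n) :
    a v v ≤ μ := by
  have h1 := (hm.sub (hw.const_mul 2)).add (hu.const_mul θ)
  have h2 : -(a v v) ≤ μ - 2 * a v v + θ * 0 := by
    refine le_of_tendsto_of_tendsto tendsto_const_nhds h1 (hum.mono fun n hn => ?_)
    have h3 := h.nonneg (u n - v)
    rw [bilin_sub_self h.symm_a] at h3
    linarith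
  linarith

/-- The Rayleigh quotient attains its minimum under finitely many orthogonality constraints. -/
theorem exists_minimizer (h : CompactPair a b θ) {t : Set V}
    (ht : ∃ u : V, u ≠ 0 ∧ ∀ v ∈ t, b v u = 0) :
    ∃ c, b c c = 1 ∧ (∀ v ∈ t, b v c = 0) ∧
      ∀ u, (∀ v ∈ t, b v u = 0) → a c c * b u u ≤ a u u := by
  set S : Set ℝ := {r | ∃ u, b u u = 1 ∧ (∀ v ∈ t, b v u = 0) ∧ a u u = r} with hS
  have hmem : ∀ u, u ≠ 0 → (∀ v ∈ t, b v u = 0) → a u u / b u u ∈ S := by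
    intro u hu hut
    have hpos := h.pos u hu
    refine ⟨(Real.sqrt (b u u))⁻¹ • u, ?_, ?_, ?_⟩
    · rw [bilin_smul_self, inv_pow, Real.sq_sqrt hpos.le]
      field_simp
    · intro v hv
      simp [hut v hv]
    · rw [bilin_smul_self, inv_pow, Real.sq_sqrt hpos.le]
      field_simp
  have hne : S.Nonempty := by
    obtain ⟨u, hu, hut⟩ := ht
    exact ⟨_, hmem u hu hut⟩
  have hbdd : BddBelow S := by
    refine ⟨-θ, ?_⟩
    rintro r ⟨u, hu, -, rfl⟩
    have := h.nonneg u
    rw [hu] at this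
    linarith
  obtain ⟨r, hr, hlim, hrS⟩ := exists_seq_tendsto_sInf hne hbdd
  choose u hu hut hur using hrS
  obtain ⟨v, s, hs, hv, hw⟩ := h.compact u (r 0 + θ) fun n => by
    rw [hu, hur]
    have := hr (Nat.zero_le n)
    linarith
  have hbv : b v v = 1 := by
    refine tendsto_nhds_unique (h.tendsto_b_self hv) ?_
    simp [hu]
  have hvt : ∀ z ∈ t, b z v = 0 := by
    intro z hz
    rw [h.symm_b]
    refine tendsto_nhds_unique (h.tendsto_b hv z) ?_
    refine tendsto_const_nhds.congr fun n => ?_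
    rw [h.symm_b, hut _ z hz]
  have hav : a v v ≤ sInf S :=
    h.a_le_of_eventually_le hv (hw v) (hlim.comp hs.tendsto_atTop)
      (Eventually.of_forall fun n => (hur (s n)).le)
  refine ⟨v, hbv, hvt, fun w hwt => ?_⟩
  rcases eq_or_ne w 0 with rfl | hw0
  · simp
  · have := hav.trans (csInf_le hbdd (hmem w hw0 hwt))
    rwa [le_div_iff₀ (h.pos w hw0)] at this

/-- A vector that realizes equality in `m b ≤ a` on the orthogonal complement of finitely many
orthonormal eigenvectors, and lies in that complement, is an eigenvector. -/
theorem eigen_of_min (h : CompactPair a b θ) {e : ℕ → V} {ν : ℕ → ℝ} {k : ℕ}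
    (ho : ∀ i < k, ∀ j < k, b (e i) (e j) = if i = j then 1 else 0)
    (he : ∀ i < k, ∀ v, a (e i) v = ν i * b (e i) v) {m : ℝ}
    (hmin : ∀ u, (∀ i < k, b (e i) u = 0) → m * b u u ≤ a u u) {c : V}
    (hc : ∀ i < k, b (e i) c = 0) (hcm : a c c = m * b c c) (w : V) :
    a c w = m * b c w := by
  set w' := w - ∑ i ∈ Finset.range k, b (e i) w • e i with hw'
  have hw0 : ∀ i < k, b (e i) w' = 0 := fun i hi => bilin_sub_fourier h.symm_b ho w hi
  have key : (a - m • b) c w' = 0 := by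
    refine bilin_eq_zero_of_nonneg_on_line ?_ (fun s => ?_) ?_
    · intro u v
      simp [h.symm_a u v, h.symm_b u v]
    · have := hmin (c + s • w') fun i hi => by simp [hc i hi, hw0 i hi]
      simpa only [LinearMap.sub_apply, LinearMap.smul_apply, smul_eq_mul, sub_nonneg] using this
    · simp [hcm]
  have hw : w = w' + ∑ i ∈ Finset.range k, b (e i) w • e i := by simp [hw']
  have hz : ∀ d : LinearMap.BilinForm ℝ V, (∀ i < k, d c (e i) = 0) → d c w = d c w' := by
    intro d hd
    conv_lhs => rw [hw]
    rw [map_add, bilin_sum_right, Finset.sum_eq_zero, add_zero]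
    intro i hi
    rw [hd i (Finset.mem_range.mp hi), mul_zero]
  rw [hz a fun i hi => by rw [h.symm_a, he i hi, hc i hi, mul_zero],
    hz b fun i hi => by rw [h.symm_b, hc i hi]]
  simp only [LinearMap.sub_apply, LinearMap.smul_apply, smul_eq_mul] at key
  linarith

end CompactPair

/-- A complete system of `b`-orthonormal eigenvectors of `a` relative to `b`, in increasing order
of the eigenvalues. Completeness is encoded by the variational property `min`. -/
structure EigenSystem (a b : LinearMap.BilinForm ℝ V) (e : ℕ → V) (μ : ℕ → ℝ) : Prop where
  ortho : ∀ i j, b (e i) (e j) = if i = j then 1 else 0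
  eigen : ∀ i v, a (e i) v = μ i * b (e i) v
  mono : Monotone μ
  min : ∀ k u, (∀ i < k, b (e i) u = 0) → μ k * b u u ≤ a u u
  unbounded : ∀ c, ∃ k, c < μ k

/-- The spectral theorem for compact pairs, by successive minimization. -/
theorem CompactPair.exists_eigenSystem {a b : LinearMap.BilinForm ℝ V} {θ : ℝ}
    (h : CompactPair a b θ) (hV : ¬ FiniteDimensional ℝ V) :
    ∃ (e : ℕ → V) (μ : ℕ → ℝ), EigenSystem a b e μ := by
  obtain ⟨e, he⟩ := Set.seq_of_forall_finite_exists
    (P := fun c t => b c c = 1 ∧ (∀ v ∈ t, b v c = 0) ∧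
      ∀ u, (∀ v ∈ t, b v u = 0) → a c c * b u u ≤ a u u)
    (fun t ht => h.exists_minimizer (exists_ne_zero_orthogonal hV b ht))
  have hlt : ∀ i j, i < j → b (e i) (e j) = 0 := fun i j hij =>
    (he j).2.1 _ ⟨i, hij, rfl⟩
  have hort : ∀ i j, b (e i) (e j) = if i = j then 1 else 0 := by
    intro i j
    rcases lt_trichotomy i j with hij | rfl | hij
    · rw [hlt i j hij, if_neg hij.ne]
    · rw [(he i).1, if_pos rfl]
    · rw [h.symm_b, hlt j i hij, if_neg hij.ne']
  have hmin : ∀ k u, (∀ i < k, b (e i) u = 0) → a (e k) (e k) * b u u ≤ a u u := by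
    intro k u hu
    refine (he k).2.2 u ?_
    rintro v ⟨i, hi, rfl⟩
    exact hu i hi
  refine ⟨e, fun k => a (e k) (e k), hort, ?_, ?_, hmin, ?_⟩
  · intro k
    induction k using Nat.strong_induction_on with
    | _ k ih =>
      exact h.eigen_of_min (k := k) (ν := fun k => a (e k) (e k)) (fun i _ j _ => hort i j) ih
        (hmin k) (fun i hi => hlt i k hi) (by rw [(he k).1, mul_one])
  · intro k l hkl
    have := hmin k (e l) fun i hi => hlt i l (hi.trans_le hkl)
    simpa [(he l).1] using this
  · intro c
    by_contra! hc
    obtain ⟨v, s, hs, hv, -⟩ := h.compact e (c + θ) fun n => by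
      rw [(he n).1]
      have := hc n
      linarith
    have h1 := hv.add (hv.comp (tendsto_add_atTop_nat 1))
    have h2 : (1 : ℝ) ≤ 0 + 0 := by
      refine ge_of_tendsto h1 (Eventually.of_forall fun n => ?_)
      -- the parallelogram inequality `‖x - y‖² ≤ 2 ‖x‖² + 2 ‖y‖²`
      have h3 := h.b_nonneg ((e (s n) - v) + (1 : ℝ) • (e (s (n + 1)) - v))
      have h4 : b (e (s n) - e (s (n + 1))) (e (s n) - e (s (n + 1))) = 2 := by
        rw [bilin_sub_self h.symm_b, hlt _ _ (hs n.lt_succ_self), (he _).1, (he _).1]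
        norm_num
      rw [show e (s n) - e (s (n + 1)) = (e (s n) - v) - (e (s (n + 1)) - v) by abel,
        bilin_sub_self h.symm_b] at h4
      rw [bilin_add_smul_self h.symm_b] at h3
      simp only [Function.comp]
      linarith
    linarith

namespace EigenSystem

variable {a b : LinearMap.BilinForm ℝ V} {θ : ℝ} {e : ℕ → V} {μ : ℕ → ℝ}

theorem eigenvector_orthogonal (he : EigenSystem a b e μ) (h : CompactPair a b θ) {u : V} {s : ℝ}
    (hu : ∀ v, a u v = s * b u v) {i : ℕ} (hi : μ i ≠ s) : b (e i) u = 0 := by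
  have h1 := he.eigen i u
  rw [h.symm_a, hu, h.symm_b u] at h1
  have h2 : (μ i - s) * b (e i) u = 0 := by linarith
  exact (mul_eq_zero.mp h2).resolve_left (sub_ne_zero.mpr hi)

/-- Every eigenvector is the (finite) sum of its Fourier series. -/
theorem eigenvector_eq_sum (he : EigenSystem a b e μ) (h : CompactPair a b θ) {u : V} {s : ℝ}
    (hu : ∀ v, a u v = s * b u v) {k : ℕ} (hk : s < μ k) :
    u = ∑ i ∈ Finset.range k, b (e i) u • e i := by
  have ho : ∀ i < k, ∀ j < k, b (e i) (e j) = if i = j then 1 else 0 := fun i _ j _ => he.ortho i j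
  set r := u - ∑ i ∈ Finset.range k, b (e i) u • e i with hr
  have hr0 : ∀ i < k, b (e i) r = 0 := fun i hi => bilin_sub_fourier h.symm_b ho u hi
  have hra : a r r = s * b r r := by
    have h1 : a u r = s * b u r := hu r
    have h2 : a (∑ i ∈ Finset.range k, b (e i) u • e i) r = 0 := by
      rw [bilin_sum_left, Finset.sum_eq_zero]
      intro i hi
      rw [he.eigen, hr0 i (Finset.mem_range.mp hi)]
      simp
    have h3 : b (∑ i ∈ Finset.range k, b (e i) u • e i) r = 0 := by
      rw [bilin_sum_left, Finset.sum_eq_zero]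
      intro i hi
      rw [hr0 i (Finset.mem_range.mp hi)]
      simp
    have h4 : a r r = a u r := by
      rw [← sub_eq_zero, ← LinearMap.sub_apply, ← map_sub, hr, sub_sub_cancel_left, map_neg,
        LinearMap.neg_apply, ← hr, h2, neg_zero]
    have h5 : b r r = b u r := by
      rw [← sub_eq_zero, ← LinearMap.sub_apply, ← map_sub, hr, sub_sub_cancel_left, map_neg,
        LinearMap.neg_apply, ← hr, h3, neg_zero]
    rw [h4, h5, h1]
  have h6 := he.min k r hr0
  have h7 : r = 0 := h.eq_zero_of_b_nonpos (by nlinarith)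
  exact sub_eq_zero.mp h7

/-- Courant–Fischer: among the normalized combinations of `p + 1` vectors, one has Rayleigh
quotient at least `μ p`. -/
theorem exists_ge (he : EigenSystem a b e μ) (p : ℕ) (f : ℕ → V) :
    ∃ c : ℕ → ℝ, ∑ i ∈ Finset.range (p + 1), c i ^ 2 = 1 ∧
      μ p * b (∑ i ∈ Finset.range (p + 1), c i • f i) (∑ i ∈ Finset.range (p + 1), c i • f i)
        ≤ a (∑ i ∈ Finset.range (p + 1), c i • f i) (∑ i ∈ Finset.range (p + 1), c i • f i) := by
  obtain ⟨c, hc1, hc⟩ := exists_unit_mem_ker (U := Fin p → ℝ) (m := p + 1)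
    (LinearMap.pi fun i : Fin p => (b (e i)) ∘ₗ Fintype.linearCombination ℝ fun i => f i) (by simp)
  refine ⟨c, hc1, he.min p _ fun i hi => ?_⟩
  have := congrFun hc ⟨i, hi⟩
  simpa [Fintype.linearCombination_apply, Finset.sum_range] using this

/-- Courant–Fischer: a linear map of rank at most `p` vanishes at some normalized vector with
Rayleigh quotient at most `μ p`. -/
theorem exists_le (he : EigenSystem a b e μ) (p : ℕ) {U : Type*} [AddCommGroup U] [Module ℝ U]
    [FiniteDimensional ℝ U] (T : V →ₗ[ℝ] U) (hU : Module.finrank ℝ U ≤ p) :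
    ∃ w : V, w ≠ 0 ∧ T w = 0 ∧ a w w ≤ μ p * b w w := by
  obtain ⟨c, hc1, hc⟩ := exists_unit_mem_ker (U := U) (m := p + 1)
    (T ∘ₗ Fintype.linearCombination ℝ fun i => e i) (by omega)
  have ho : ∀ i < p + 1, ∀ j < p + 1, b (e i) (e j) = if i = j then 1 else 0 :=
    fun i _ j _ => he.ortho i j
  have hb := bilin_sum_orthonormal_self ho c
  refine ⟨∑ i ∈ Finset.range (p + 1), c i • e i, ?_, ?_, ?_⟩
  · intro h0
    rw [h0, hc1] at hb
    simp at hb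
  · simpa [Fintype.linearCombination_apply, Finset.sum_range] using hc
  · have ha : a (∑ i ∈ Finset.range (p + 1), c i • e i) (∑ i ∈ Finset.range (p + 1), c i • e i)
        = ∑ i ∈ Finset.range (p + 1), μ i * c i ^ 2 := by
      rw [bilin_sum_left]
      refine Finset.sum_congr rfl fun i hi => ?_
      rw [he.eigen, bilin_sum_right, Finset.sum_congr rfl
        (g := fun j => if i = j then c j else 0)]
      · rw [Finset.sum_ite_eq, if_pos hi]
        ring
      · intro j _
        rw [he.ortho]
        simp
    rw [ha, hb, Finset.mul_sum]
    refine Finset.sum_le_sum fun i hi => ?_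
    exact mul_le_mul_of_nonneg_right (he.mono (Nat.lt_succ_iff.mp (Finset.mem_range.mp hi)))
      (sq_nonneg _)

end EigenSystem
end BilinForm

/-! ### One-sided first order perturbation of the eigenvalues -/

section Perturbation

variable {V : Type*} [AddCommGroup V] [Module ℝ V]

/-- Along the convergence given by `CompactPair.compact`, normalized vectors whose energies are
bounded by a sequence with limit `μ` converge strongly as soon as the limit has energy `μ`. -/
theorem CompactPair.exists_limit {a b : LinearMap.BilinForm ℝ V} {θ : ℝ} (h : CompactPair a b θ)
    {w : ℕ → V} {m : ℕ → ℝ} {μ : ℝ} (hw : ∀ n, b (w n) (w n) = 1) (hm : Tendsto m atTop (𝓝 μ))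
    (hwm : ∀ n, a (w n) (w n) ≤ m n) :
    ∃ v, ∃ s : ℕ → ℕ, StrictMono s ∧ b v v = 1 ∧
      Tendsto (fun n => b (w (s n) - v) (w (s n) - v)) atTop (𝓝 0) ∧ a v v ≤ μ ∧
      (μ ≤ a v v → Tendsto (fun n => a (w (s n) - v) (w (s n) - v)
        + θ * b (w (s n) - v) (w (s n) - v)) atTop (𝓝 0)) := by
  obtain ⟨M, hM⟩ := hm.bddAbove_range
  obtain ⟨v, s, hs, hv, hav⟩ := h.compact w (M + θ) fun n => by
    have h1 : m n ≤ M := hM ⟨n, rfl⟩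
    have h2 := hwm n
    rw [hw]
    linarith
  have hms := hm.comp hs.tendsto_atTop
  refine ⟨v, s, hs, ?_, hv, ?_, fun hμ => ?_⟩
  · refine tendsto_nhds_unique (h.tendsto_b_self hv) ?_
    simp [hw]
  · exact h.a_le_of_eventually_le hv (hav v) hms (Eventually.of_forall fun n => hwm (s n))
  · have h1 := ((hms.sub ((hav v).const_mul 2)).add_const (a v v)).add (hv.const_mul θ)
    have h2 : a v v = μ := le_antisymm
      (h.a_le_of_eventually_le hv (hav v) hms (Eventually.of_forall fun n => hwm (s n))) hμ
    refine tendsto_of_tendsto_of_tendsto_of_le_of_le tendsto_const_nhds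
      (h1.trans_eq (by rw [h2]; congr 1; ring)) (fun n => h.nonneg _) (fun n => ?_)
    have h3 := hwm (s n)
    simp only [Function.comp]
    rw [bilin_sub_self h.symm_a]
    linarith

/-- The norm attached to the form `a + θ b`. -/
noncomputable def formNorm (a b : LinearMap.BilinForm ℝ V) (θ : ℝ) (u : V) : ℝ :=
  Real.sqrt (a u u + θ * b u u)

theorem formNorm_nonneg (a b : LinearMap.BilinForm ℝ V) (θ : ℝ) (u : V) :
    0 ≤ formNorm a b θ u := Real.sqrt_nonneg _

theorem CompactPair.formNorm_mul_self {a b : LinearMap.BilinForm ℝ V} {θ : ℝ}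
    (h : CompactPair a b θ) (u : V) :
    formNorm a b θ u * formNorm a b θ u = a u u + θ * b u u :=
  Real.mul_self_sqrt (h.nonneg u)

/-- The family `d` of forms is differentiable from the right at `0`, with derivative `d'` of the
quadratic form and with increments that are Lipschitz for the seminorm `N`. -/
structure FormDeriv (d : ℝ → LinearMap.BilinForm ℝ V) (N : V → ℝ) (C : ℝ) (d' : V → ℝ) :
    Prop where
  bound : ∀ᶠ t in 𝓝[>] (0 : ℝ), ∀ u v, |d t u v - d 0 u v| ≤ C * t * (N u * N v)
  deriv : ∀ u, Tendsto (fun t => (d t u u - d 0 u u) / t) (𝓝[>] 0) (𝓝 (d' u))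

namespace FormDeriv

variable {d : ℝ → LinearMap.BilinForm ℝ V} {N : V → ℝ} {C : ℝ} {d' : V → ℝ}

theorem abs_le (h : FormDeriv d N C d') (u : V) : |d' u| ≤ C * (N u * N u) := by
  refine le_of_tendsto (h.deriv u).abs ?_
  filter_upwards [h.bound, self_mem_nhdsWithin] with t ht ht0
  have ht0 : 0 < t := ht0
  rw [abs_div, abs_of_pos ht0, div_le_iff₀ ht0]
  linarith [ht u u]

theorem smul_self (h : FormDeriv d N C d') (s : ℝ) (u : V) : d' (s • u) = s ^ 2 * d' u := by
  refine tendsto_nhds_unique (h.deriv (s • u)) (((h.deriv u).const_mul (s ^ 2)).congr fun t => ?_)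
  rw [bilin_smul_self, bilin_smul_self]
  ring

theorem sub_smul {e : ℝ → LinearMap.BilinForm ℝ V} {e' : V → ℝ}
    (h : FormDeriv d N C d') (he : FormDeriv e N C e') (μ : ℝ) :
    FormDeriv (fun t => d t - μ • e t) N (C * (1 + |μ|)) (fun u => d' u - μ * e' u) where
  bound := by
    filter_upwards [h.bound, he.bound, self_mem_nhdsWithin] with t h1 h2 ht u v
    simp only [LinearMap.sub_apply, LinearMap.smul_apply, smul_eq_mul]
    calc |d t u v - μ * e t u v - (d 0 u v - μ * e 0 u v)|
        = |(d t u v - d 0 u v) - μ * (e t u v - e 0 u v)| := by ring_nf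
      _ ≤ |d t u v - d 0 u v| + |μ| * |e t u v - e 0 u v| := by
          rw [← abs_mul]
          exact abs_sub _ _
      _ ≤ C * t * (N u * N v) + |μ| * (C * t * (N u * N v)) :=
          add_le_add (h1 u v) (mul_le_mul_of_nonneg_left (h2 u v) (abs_nonneg μ))
      _ = C * (1 + |μ|) * t * (N u * N v) := by ring
  deriv u := by
    refine ((h.deriv u).sub ((he.deriv u).const_mul μ)).congr fun t => ?_
    simp only [LinearMap.sub_apply, LinearMap.smul_apply, smul_eq_mul]
    ring

/-- The derivative may be computed along strongly convergent sequences. -/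
theorem tendsto_along (h : FormDeriv d N C d') (hN : ∀ u, 0 ≤ N u) {t : ℕ → ℝ}
    (ht : Tendsto t atTop (𝓝[>] 0))
    {w : ℕ → V} {v : V} {M : ℝ} (hwM : ∀ n, N (w n) ≤ M)
    (hwv : Tendsto (fun n => N (w n - v)) atTop (𝓝 0)) :
    Tendsto (fun n => (d (t n) (w n) (w n) - d 0 (w n) (w n)) / t n) atTop (𝓝 (d' v)) := by
  have hM : 0 ≤ M := (hN _).trans (hwM 0)
  have h1 : Tendsto (fun n => (d (t n) (w n) (w n) - d 0 (w n) (w n)) / t n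
      - (d (t n) v v - d 0 v v) / t n) atTop (𝓝 0) := by
    refine squeeze_zero_norm' (a := fun n => |C| * (M + N v) * N (w n - v)) ?_ ?_
    · filter_upwards [ht.eventually h.bound, ht.eventually self_mem_nhdsWithin] with n hb h0
      have h0 : 0 < t n := h0
      have h2 := hb (w n - v) (w n)
      have h3 := hb v (w n - v)
      have h4 : (d (t n) (w n) (w n) - d 0 (w n) (w n)) / t n - (d (t n) v v - d 0 v v) / t n
          = ((d (t n) (w n - v) (w n) - d 0 (w n - v) (w n))
            + (d (t n) v (w n - v) - d 0 v (w n - v))) / t n := by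
        simp only [map_sub, LinearMap.sub_apply]
        ring
      rw [h4, Real.norm_eq_abs, abs_div, abs_of_pos h0, div_le_iff₀ h0]
      have h5 : 0 ≤ N (w n - v) * t n := mul_nonneg (hN _) h0.le
      have h6 : C * t n * (N (w n - v) * N (w n)) ≤ |C| * M * (N (w n - v) * t n) := by
        have : C * N (w n) ≤ |C| * M :=
          (mul_le_mul_of_nonneg_right (le_abs_self C) (hN _)).trans
            (mul_le_mul_of_nonneg_left (hwM n) (abs_nonneg C))
        nlinarith
      have h7 : C * t n * (N v * N (w n - v)) ≤ |C| * N v * (N (w n - v) * t n) := by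
        have : C * N v ≤ |C| * N v := mul_le_mul_of_nonneg_right (le_abs_self C) (hN _)
        nlinarith
      linarith [abs_add_le (d (t n) (w n - v) (w n) - d 0 (w n - v) (w n))
        (d (t n) v (w n - v) - d 0 v (w n - v))]
    · simpa using hwv.const_mul (|C| * (M + N v))
  have h2 := h1.add ((h.deriv v).comp ht)
  rw [zero_add] at h2
  exact h2.congr fun n => by simp [Function.comp]

/-- Uniform convergence of the forms on bounded sequences. -/
theorem tendsto_sub_along (h : FormDeriv d N C d') (hN : ∀ u, 0 ≤ N u) {t : ℕ → ℝ}
    (ht : Tendsto t atTop (𝓝[>] 0))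
    {w : ℕ → V} {M : ℝ} (hwM : ∀ n, N (w n) ≤ M) :
    Tendsto (fun n => d (t n) (w n) (w n) - d 0 (w n) (w n)) atTop (𝓝 0) := by
  refine squeeze_zero_norm' (a := fun n => |C| * (M * M) * t n) ?_ ?_
  · filter_upwards [ht.eventually h.bound, ht.eventually self_mem_nhdsWithin] with n hb h0
    have h0 : 0 < t n := h0
    have h1 : N (w n) * N (w n) ≤ M * M := mul_self_le_mul_self (hN _) (hwM n)
    have h2 : C * (N (w n) * N (w n)) ≤ |C| * (M * M) :=
      (mul_le_mul_of_nonneg_right (le_abs_self C) (mul_self_nonneg _)).trans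
        (mul_le_mul_of_nonneg_left h1 (abs_nonneg C))
    rw [Real.norm_eq_abs]
    nlinarith [hb (w n) (w n)]
  · simpa using (ht.mono_right nhdsWithin_le_nhds).const_mul (|C| * (M * M))

end FormDeriv

/-- A one-parameter family of pairs of forms, differentiable from the right at `0`. -/
structure PerturbedPair (a b : ℝ → LinearMap.BilinForm ℝ V) (θ C : ℝ) (a' b' : V → ℝ) :
    Prop where
  pair : CompactPair (a 0) (b 0) θ
  const_nonneg : 0 ≤ C
  nonneg_b : ∀ᶠ t in 𝓝[>] (0 : ℝ), ∀ u, 0 ≤ b t u u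
  deriv_a : FormDeriv a (formNorm (a 0) (b 0) θ) C a'
  deriv_b : FormDeriv b (formNorm (a 0) (b 0) θ) C b'

namespace PerturbedPair

variable {a b : ℝ → LinearMap.BilinForm ℝ V} {θ C : ℝ} {a' b' : V → ℝ}

theorem deriv_sub (h : PerturbedPair a b θ C a' b') (μ : ℝ) :
    FormDeriv (fun t => a t - μ • b t) (formNorm (a 0) (b 0) θ) (C * (1 + |μ|))
      (fun u => a' u - μ * b' u) :=
  h.deriv_a.sub_smul h.deriv_b μ

/-- On vectors with Rayleigh quotient `μ` the derivative of `a - μ b` is controlled by `b`. -/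
theorem abs_deriv_le (h : PerturbedPair a b θ C a' b') {μ : ℝ} {u : V}
    (hu : a 0 u u = μ * b 0 u u) :
    |a' u - μ * b' u| ≤ C * (1 + |μ|) * (μ + θ) * b 0 u u := by
  have h1 := (h.deriv_sub μ).abs_le u
  rw [h.pair.formNorm_mul_self, hu] at h1
  linarith

/-- The lower bound for the `p`-th eigenvalue, obtained from `p` linear constraints under which
`a 0 ≥ μ b 0`. The constraints say that the vector of the pairings with `f 0, …, f (m - 1)` lies
in a subspace `S` of codimension at most `p`. -/
theorem eventually_ge (h : PerturbedPair a b θ C a' b') {p : ℕ} {κ : ℝ → ℝ}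
    (hκ : ∀ᶠ t in 𝓝[>] (0 : ℝ), ∃ e μ, EigenSystem (a t) (b t) e μ ∧ μ p = κ t)
    {m : ℕ} (f : Fin m → V) (S : Submodule ℝ (Fin m → ℝ)) (hS : m ≤ p + Module.finrank ℝ S)
    {μ c : ℝ} (hmin : ∀ w, (fun i => b 0 (f i) w) ∈ S → μ * b 0 w w ≤ a 0 w w)
    (hc : ∀ w, (fun i => b 0 (f i) w) ∈ S → a 0 w w = μ * b 0 w w →
      c * b 0 w w ≤ a' w - μ * b' w) {c' : ℝ} (hc' : c' < c) :
    ∀ᶠ t in 𝓝[>] (0 : ℝ), μ + t * c' ≤ κ t := by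
  by_contra hcon
  rw [not_eventually] at hcon
  set N := formNorm (a 0) (b 0) θ with hN
  have hN0 : ∀ u, 0 ≤ N u := formNorm_nonneg _ _ _
  -- `R` bounds `|μ + t c'|` for `0 ≤ t ≤ 1`
  set R := |μ| + |c'| with hR
  have hR0 : 0 ≤ R := by positivity
  have hsmall : ∀ᶠ t in 𝓝[>] (0 : ℝ), C * (1 + R) * t ≤ 1 / 2 := by
    have : Tendsto (fun t : ℝ => C * (1 + R) * t) (𝓝[>] 0) (𝓝 0) := by
      have := (tendsto_nhdsWithin_of_tendsto_nhds tendsto_id :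
        Tendsto (fun t : ℝ => t) (𝓝[>] 0) (𝓝 0)).const_mul (C * (1 + R))
      simpa using this
    exact this.eventually_le_const (by norm_num)
  have hone : ∀ᶠ t in 𝓝[>] (0 : ℝ), t ≤ 1 :=
    eventually_nhdsWithin_of_eventually_nhds (eventually_le_nhds one_pos)
  have hall := hcon.and_eventually ((hκ.and h.nonneg_b).and ((h.deriv_a.bound.and
    h.deriv_b.bound).and ((hsmall.and hone).and self_mem_nhdsWithin)))
  obtain ⟨t, ht, hprop⟩ := exists_seq_forall_of_frequently hall
  -- constrained test vectors with small Rayleigh quotient at time `t n`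
  have hex : ∀ n, ∃ w, b 0 w w = 1 ∧ (fun i => b 0 (f i) w) ∈ S ∧
      a (t n) w w ≤ (μ + t n * c') * b (t n) w w := by
    intro n
    obtain ⟨hlt, ⟨⟨e, ν, he, hν⟩, hb⟩, -⟩ := hprop n
    have hrank : Module.finrank ℝ ((Fin m → ℝ) ⧸ S) ≤ p := by
      have := S.finrank_quotient_add_finrank
      rw [Module.finrank_fin_fun] at this
      omega
    obtain ⟨w, hw0, hwS, hw⟩ := he.exists_le p
      (S.mkQ ∘ₗ LinearMap.pi fun i => b 0 (f i)) hrank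
    have hpos := h.pair.pos w hw0
    have hsq := Real.sq_sqrt hpos.le
    have hwS' : (fun i => b 0 (f i) w) ∈ S := by
      rw [LinearMap.comp_apply, Submodule.mkQ_apply, Submodule.Quotient.mk_eq_zero] at hwS
      exact hwS
    refine ⟨(Real.sqrt (b 0 w w))⁻¹ • w, ?_, ?_, ?_⟩
    · rw [bilin_smul_self, inv_pow, hsq, inv_mul_cancel₀ hpos.ne']
    · have : (fun i => b 0 (f i) ((Real.sqrt (b 0 w w))⁻¹ • w))
          = (Real.sqrt (b 0 w w))⁻¹ • fun i => b 0 (f i) w := by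
        ext i
        simp
      rw [this]
      exact S.smul_mem _ hwS'
    · rw [bilin_smul_self, bilin_smul_self]
      rw [hν] at hw
      have h1 : a (t n) w w ≤ (μ + t n * c') * b (t n) w w :=
        hw.trans (mul_le_mul_of_nonneg_right (not_le.mp hlt).le (hb w))
      have h2 := mul_le_mul_of_nonneg_left h1 (sq_nonneg (Real.sqrt (b 0 w w))⁻¹)
      linarith
  choose w hw1 hwS hwle using hex
  -- they are bounded, and their energy at time `0` is asymptotically at most `μ`
  have henergy : ∀ n, a 0 (w n) (w n)
      ≤ μ + t n * (c' + C * (1 + R) * (2 * (R + θ))) ∧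
      N (w n) * N (w n) ≤ 2 * (R + θ) := by
    intro n
    obtain ⟨-, -, ⟨hba, hbb⟩, ⟨hs, h1⟩, h0⟩ := hprop n
    have h0 : 0 < t n := h0
    have hX := h.pair.formNorm_mul_self (w n)
    rw [← hN, hw1] at hX
    have hX0 : 0 ≤ N (w n) * N (w n) := mul_self_nonneg _
    have e1 := (abs_le.mp (hba (w n) (w n))).1
    have e2 := (abs_le.mp (hbb (w n) (w n)))
    rw [hw1] at e2
    have e3 := hwle n
    have hR1 : |μ + t n * c'| ≤ R := by
      refine (abs_add_le _ _).trans (add_le_add le_rfl ?_)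
      rw [abs_mul, abs_of_pos h0]
      exact mul_le_of_le_one_left (abs_nonneg _) h1
    set X := N (w n) * N (w n) with hXdef
    have hCX : 0 ≤ C * t n * X := (abs_nonneg _).trans (hbb (w n) (w n))
    have e4 : (μ + t n * c') * (b (t n) (w n) (w n) - 1) ≤ R * (C * t n * X) := by
      refine (le_abs_self _).trans ?_
      rw [abs_mul]
      refine mul_le_mul hR1 ?_ (abs_nonneg _) hR0
      exact abs_le.mpr ⟨by linarith [e2.1], by linarith [e2.2]⟩
    have e5 : a 0 (w n) (w n) ≤ μ + t n * c' + C * (1 + R) * t n * X := by nlinarith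
    have e6 : X ≤ 2 * (R + θ) := by
      have : C * (1 + R) * t n * X ≤ 1 / 2 * X := mul_le_mul_of_nonneg_right hs hX0
      have := (le_abs_self _).trans hR1
      linarith
    refine ⟨?_, e6⟩
    have hC : 0 ≤ C * (1 + R) * t n := mul_nonneg (mul_nonneg h.const_nonneg (by linarith)) h0.le
    have e7 := mul_le_mul_of_nonneg_left e6 hC
    linarith
  have ht0 := ht.mono_right nhdsWithin_le_nhds
  have hbound : ∀ n, N (w n) ≤ Real.sqrt (2 * (R + θ)) := fun n =>
    Real.le_sqrt_of_sq_le (by rw [sq]; exact (henergy n).2)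
  obtain ⟨v, s, hs, hv1, hbv, hav, hstrong⟩ := h.pair.exists_limit hw1
    (m := fun n => μ + t n * (c' + C * (1 + R) * (2 * (R + θ)))) (μ := μ)
    (by simpa using (ht0.mul_const (c' + C * (1 + R) * (2 * (R + θ)))).const_add μ)
    fun n => (henergy n).1
  have hvS : (fun i => b 0 (f i) v) ∈ S := by
    refine (Submodule.closed_of_finiteDimensional S).mem_of_tendsto
      (f := fun n => fun i => b 0 (f i) (w (s n))) (b := atTop) ?_
      (Eventually.of_forall fun n => hwS (s n))
    refine tendsto_pi_nhds.mpr fun i => ?_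
    simp_rw [h.pair.symm_b (f i)]
    exact h.pair.tendsto_b hbv (f i)
  have hμv : μ ≤ a 0 v v := by simpa [hv1] using hmin v hvS
  have hts := ht.comp hs.tendsto_atTop
  have hNv : Tendsto (fun n => N (w (s n) - v)) atTop (𝓝 0) := by
    have := (hstrong hμv).sqrt
    rw [Real.sqrt_zero] at this
    exact this
  have hlim := (h.deriv_sub μ).tendsto_along hN0 hts (fun n => hbound (s n)) hNv
  have hlimb := h.deriv_b.tendsto_sub_along hN0 hts (w := fun n => w (s n)) fun n => hbound (s n)
  have hlimb' : Tendsto (fun n => c' * b (t (s n)) (w (s n)) (w (s n))) atTop (𝓝 (c' * 1)) := by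
    refine Tendsto.const_mul c' ?_
    have := hlimb.add_const 1
    simpa [hw1] using this
  have hle : a' v - μ * b' v ≤ c' * 1 := by
    refine le_of_tendsto_of_tendsto hlim hlimb' (Eventually.of_forall fun n => ?_)
    obtain ⟨-, -, -, -, h0⟩ := hprop (s n)
    have h0 : 0 < t (s n) := h0
    simp only [Function.comp, LinearMap.sub_apply, LinearMap.smul_apply, smul_eq_mul]
    rw [div_le_iff₀ h0]
    linarith [hwle (s n), hmin _ (hwS (s n))]
  have := hc v hvS (by rw [hv1, mul_one]; exact le_antisymm hav hμv)
  rw [hv1] at this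
  linarith

/-- The upper bound for the `p`-th eigenvalue, obtained from `p + 1` orthonormal eigenvectors at
time `0` with eigenvalues at most `μ`. -/
theorem eventually_le (h : PerturbedPair a b θ C a' b') {p : ℕ} {κ : ℝ → ℝ}
    (hκ : ∀ᶠ t in 𝓝[>] (0 : ℝ), ∃ e μ, EigenSystem (a t) (b t) e μ ∧ μ p = κ t)
    {f : ℕ → V} {ν : ℕ → ℝ} {μ c : ℝ}
    (ho : ∀ i < p + 1, ∀ j < p + 1, b 0 (f i) (f j) = if i = j then 1 else 0)
    (he : ∀ i < p + 1, ∀ v, a 0 (f i) v = ν i * b 0 (f i) v) (hν : ∀ i < p + 1, ν i ≤ μ)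
    (hc : ∀ z : ℕ → ℝ, (∀ i < p + 1, ν i ≠ μ → z i = 0) →
      ∑ i ∈ Finset.range (p + 1), z i ^ 2 = 1 →
      a' (∑ i ∈ Finset.range (p + 1), z i • f i) - μ * b' (∑ i ∈ Finset.range (p + 1), z i • f i)
        ≤ c) {c' : ℝ} (hc' : c < c') :
    ∀ᶠ t in 𝓝[>] (0 : ℝ), κ t ≤ μ + t * c' := by
  by_contra hcon
  rw [not_eventually] at hcon
  set N := formNorm (a 0) (b 0) θ with hN
  have hN0 : ∀ u, 0 ≤ N u := formNorm_nonneg _ _ _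
  have hall := hcon.and_eventually ((hκ.and h.nonneg_b).and self_mem_nhdsWithin)
  obtain ⟨t, ht, hprop⟩ := exists_seq_forall_of_frequently hall
  have ht0 := ht.mono_right nhdsWithin_le_nhds
  set F : (ℕ → ℝ) → V := fun z => ∑ i ∈ Finset.range (p + 1), z i • f i with hF
  have hFb : ∀ z, b 0 (F z) (F z) = ∑ i ∈ Finset.range (p + 1), z i ^ 2 := fun z =>
    bilin_sum_orthonormal_self ho z
  have hFa : ∀ z, a 0 (F z) (F z) = ∑ i ∈ Finset.range (p + 1), ν i * z i ^ 2 := by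
    intro z
    rw [hF]
    simp only
    rw [bilin_sum_left]
    refine Finset.sum_congr rfl fun i hi => ?_
    have hi' := Finset.mem_range.mp hi
    rw [he i hi', h.pair.symm_b, bilin_sum_orthonormal_left ho z hi']
    ring
  have hFsub : ∀ z y, F z - F y = F (fun i => z i - y i) := fun z y => by
    simp [hF, sub_smul, Finset.sum_sub_distrib]
  have hex : ∀ n, ∃ z : ℕ → ℝ, ∑ i ∈ Finset.range (p + 1), z i ^ 2 = 1 ∧
      (μ + t n * c') * b (t n) (F z) (F z) ≤ a (t n) (F z) (F z) := by
    intro n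
    obtain ⟨hlt, ⟨⟨e, ν', he', hν'⟩, hb⟩, -⟩ := hprop n
    obtain ⟨z, hz1, hz⟩ := he'.exists_ge p f
    rw [hν'] at hz
    exact ⟨z, hz1, (mul_le_mul_of_nonneg_right (not_le.mp hlt).le (hb _)).trans hz⟩
  choose z hz1 hzle using hex
  have hw1 : ∀ n, b 0 (F (z n)) (F (z n)) = 1 := fun n => by rw [hFb, hz1]
  have hwa : ∀ z : ℕ → ℝ, ∑ i ∈ Finset.range (p + 1), z i ^ 2 = 1 → a 0 (F z) (F z) ≤ μ := by
    intro z hz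
    rw [hFa, ← mul_one μ, ← hz, Finset.mul_sum]
    exact Finset.sum_le_sum fun i hi =>
      mul_le_mul_of_nonneg_right (hν i (Finset.mem_range.mp hi)) (sq_nonneg _)
  obtain ⟨v, s, hs, hv1, hbv, -, -⟩ := h.pair.exists_limit hw1 (m := fun _ => μ)
    tendsto_const_nhds fun n => hwa _ (hz1 n)
  -- the coordinates converge, so that the convergence in the span is strong
  set y : ℕ → ℝ := fun i => b 0 v (f i) with hy
  have hzy : ∀ i < p + 1, Tendsto (fun n => z (s n) i) atTop (𝓝 (y i)) := by
    intro i hi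
    refine (h.pair.tendsto_b hbv (f i)).congr fun n => ?_
    exact bilin_sum_orthonormal_left ho _ hi
  have hy1 : ∑ i ∈ Finset.range (p + 1), y i ^ 2 = 1 := by
    refine tendsto_nhds_unique (tendsto_finsetSum _ fun i hi =>
      (hzy i (Finset.mem_range.mp hi)).pow 2) ?_
    simp [hz1]
  have hNy : Tendsto (fun n => N (F (z (s n)) - F y)) atTop (𝓝 0) := by
    have : Tendsto (fun n => ∑ i ∈ Finset.range (p + 1), (ν i + θ) * (z (s n) i - y i) ^ 2) atTop
        (𝓝 (∑ i ∈ Finset.range (p + 1), (ν i + θ) * (y i - y i) ^ 2)) :=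
      tendsto_finsetSum _ fun i hi =>
        (((hzy i (Finset.mem_range.mp hi)).sub_const _).pow 2).const_mul _
    have h2 := this.sqrt
    simp only [sub_self, ne_eq, OfNat.ofNat_ne_zero, not_false_eq_true, zero_pow, mul_zero,
      Finset.sum_const_zero, Real.sqrt_zero] at h2
    refine h2.congr fun n => ?_
    rw [hN, formNorm, hFsub, hFa, hFb, Finset.mul_sum, ← Finset.sum_add_distrib]
    congr 1
    exact Finset.sum_congr rfl fun i _ => by ring
  have hbound : ∀ n, N (F (z n)) ≤ Real.sqrt (μ + θ) := by
    intro n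
    rw [hN, formNorm, hw1]
    exact Real.sqrt_le_sqrt (by linarith [hwa _ (hz1 n)])
  have hts := ht.comp hs.tendsto_atTop
  have hlim := (h.deriv_sub μ).tendsto_along hN0 hts (fun n => hbound (s n)) hNy
  have hlimb := h.deriv_b.tendsto_sub_along hN0 hts (w := fun n => F (z (s n)))
    fun n => hbound (s n)
  have hlimb' : Tendsto (fun n => c' * b (t (s n)) (F (z (s n))) (F (z (s n)))) atTop
      (𝓝 (c' * 1)) := by
    refine Tendsto.const_mul c' ?_
    have := hlimb.add_const 1
    simpa [hw1] using this
  have hle : c' * 1 ≤ a' (F y) - μ * b' (F y) := by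
    refine le_of_tendsto_of_tendsto hlimb' hlim (Eventually.of_forall fun n => ?_)
    have h0 : 0 < t (s n) := (hprop (s n)).2.2
    simp only [Function.comp, LinearMap.sub_apply, LinearMap.smul_apply, smul_eq_mul]
    rw [le_div_iff₀ h0, hw1]
    linarith [hzle (s n), hwa _ (hz1 (s n))]
  -- the limit has energy `μ`, so that it only charges the eigenvectors with eigenvalue `μ`
  have hμy : μ ≤ a 0 (F y) (F y) := by
    have hta : Tendsto (fun n => a 0 (F (z (s n))) (F (z (s n)))) atTop (𝓝 (a 0 (F y) (F y))) := by
      simp_rw [hFa]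
      exact tendsto_finsetSum _ fun i hi => ((hzy i (Finset.mem_range.mp hi)).pow 2).const_mul _
    have hta' := hta.add (h.deriv_a.tendsto_sub_along hN0 hts (w := fun n => F (z (s n)))
      fun n => hbound (s n))
    have hκ' := ((hts.mono_right nhdsWithin_le_nhds).mul_const c').const_add μ |>.mul
      (hlimb.add_const 1)
    have := le_of_tendsto_of_tendsto hκ' hta' (Eventually.of_forall fun n => by
      have := hzle (s n)
      simp only [Function.comp, hw1, sub_add_cancel, add_sub_cancel]
      exact this)
    simpa using this
  have hzero : ∀ i < p + 1, ν i ≠ μ → y i = 0 := by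
    have hsum : ∑ i ∈ Finset.range (p + 1), (μ - ν i) * y i ^ 2 ≤ 0 := by
      simp_rw [sub_mul, Finset.sum_sub_distrib]
      rw [← Finset.mul_sum, hy1, ← hFa]
      linarith
    have hterm : ∀ i ∈ Finset.range (p + 1), 0 ≤ (μ - ν i) * y i ^ 2 := fun i hi =>
      mul_nonneg (sub_nonneg.mpr (hν i (Finset.mem_range.mp hi))) (sq_nonneg _)
    have hz := (Finset.sum_eq_zero_iff_of_nonneg hterm).mp
      (le_antisymm hsum (Finset.sum_nonneg hterm))
    intro i hi hne
    have := (mul_eq_zero.mp (hz i (Finset.mem_range.mpr hi))).resolve_left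
      (sub_ne_zero.mpr hne.symm)
    simpa using this
  have := hc y hzero hy1
  linarith

end PerturbedPair
end Perturbation

/-! ### Right derivatives at the two ends of a block of equal eigenvalues -/

section Blocks

variable {V : Type*} [AddCommGroup V] [Module ℝ V]

namespace EigenSystem

variable {a b : LinearMap.BilinForm ℝ V} {e : ℕ → V} {μ : ℕ → ℝ}

/-- A combination of eigenvectors with the same eigenvalue is an eigenvector. -/
theorem eigen_sum (he : EigenSystem a b e μ) {k : ℕ} {s : ℝ} {z : ℕ → ℝ}
    (hz : ∀ i < k, μ i ≠ s → z i = 0) (v : V) :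
    a (∑ i ∈ Finset.range k, z i • e i) v = s * b (∑ i ∈ Finset.range k, z i • e i) v := by
  rw [bilin_sum_left, bilin_sum_left, Finset.mul_sum]
  refine Finset.sum_congr rfl fun i hi => ?_
  rw [he.eigen]
  by_cases h : μ i = s
  · rw [h]
    ring
  · rw [hz i (Finset.mem_range.mp hi) h]
    ring

end EigenSystem

theorem tendsto_div_of_eventually {κ : ℝ → ℝ} {μ m : ℝ}
    (hlow : ∀ c < m, ∀ᶠ t in 𝓝[>] (0 : ℝ), μ + t * c ≤ κ t)
    (hup : ∀ c, m < c → ∀ᶠ t in 𝓝[>] (0 : ℝ), κ t ≤ μ + t * c) :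
    Tendsto (fun t => (κ t - μ) / t) (𝓝[>] 0) (𝓝 m) := by
  refine tendsto_order.mpr ⟨fun r hr => ?_, fun r hr => ?_⟩
  · obtain ⟨c, hrc, hcm⟩ := exists_between hr
    filter_upwards [hlow c hcm, self_mem_nhdsWithin] with t ht h0
    have h0 : 0 < t := h0
    rw [lt_div_iff₀ h0]
    nlinarith
  · obtain ⟨c, hmc, hcr⟩ := exists_between hr
    filter_upwards [hup c hmc, self_mem_nhdsWithin] with t ht h0
    have h0 : 0 < t := h0
    rw [div_lt_iff₀ h0]
    nlinarith

namespace PerturbedPair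

variable {a b : ℝ → LinearMap.BilinForm ℝ V} {θ C : ℝ} {a' b' : V → ℝ} {e : ℕ → V} {μ : ℕ → ℝ}

/-- Every eigenvalue is Lipschitz from the right at `0`. -/
theorem eventually_abs_sub_le (h : PerturbedPair a b θ C a' b')
    (hE : EigenSystem (a 0) (b 0) e μ) {p : ℕ} {κ : ℝ → ℝ}
    (hκ : ∀ᶠ t in 𝓝[>] (0 : ℝ), ∃ e μ, EigenSystem (a t) (b t) e μ ∧ μ p = κ t) :
    ∃ L, ∀ᶠ t in 𝓝[>] (0 : ℝ), |κ t - μ p| ≤ L * t := by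
  set K := C * (1 + |μ p|) * (μ p + θ) with hK
  have hup := h.eventually_le hκ (f := e) (ν := μ) (μ := μ p) (c := K)
    (fun i _ j _ => hE.ortho i j) (fun i _ => hE.eigen i)
    (fun i hi => hE.mono (Nat.lt_succ_iff.mp hi)) (fun z hz hz1 => by
      have h1 := h.abs_deriv_le (hE.eigen_sum hz (∑ i ∈ Finset.range (p + 1), z i • e i))
      rw [bilin_sum_orthonormal_self (fun i _ j _ => hE.ortho i j), hz1, mul_one] at h1
      exact (le_abs_self _).trans h1) (lt_add_one K)
  have hlow := h.eventually_ge hκ (m := p) (fun i => e i) ⊥ (by simp) (μ := μ p) (c := -K)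
    (fun w hw => hE.min p w fun i hi => congrFun ((Submodule.mem_bot ℝ).mp hw) ⟨i, hi⟩)
    (fun w _ hw => by
      have := (abs_le.mp (h.abs_deriv_le hw)).1
      rw [← hK] at this
      linarith) (c' := -(K + 1)) (by linarith)
  refine ⟨K + 1, ?_⟩
  filter_upwards [hup, hlow] with t h1 h2
  rw [abs_le]
  constructor <;> linarith

theorem deriv_smul_self (h : PerturbedPair a b θ C a' b') (m s : ℝ) (u : V) :
    a' (s • u) - m * b' (s • u) = s ^ 2 * (a' u - m * b' u) :=
  (h.deriv_sub m).smul_self s u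

/-- The normalized eigenvectors with eigenvalue `m` give a bounded set of derivatives. -/
theorem abs_deriv_le_of_eigen (h : PerturbedPair a b θ C a' b') {m : ℝ} {u : V}
    (hu : ∀ v, a 0 u v = m * b 0 u v) (h1 : b 0 u u = 1) :
    |a' u - m * b' u| ≤ C * (1 + |m|) * (m + θ) := by
  simpa [h1] using h.abs_deriv_le (hu u)

/-- Normalization of an eigenvector. -/
theorem exists_normalize (h : PerturbedPair a b θ C a' b') {m : ℝ} {u : V} (hu0 : u ≠ 0)
    (hu : ∀ v, a 0 u v = m * b 0 u v) :
    ∃ w, (∀ v, a 0 w v = m * b 0 w v) ∧ b 0 w w = 1 ∧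
      a' u - m * b' u = b 0 u u * (a' w - m * b' w) := by
  have hpos := h.pair.pos u hu0
  have hsq := Real.sq_sqrt hpos.le
  refine ⟨(Real.sqrt (b 0 u u))⁻¹ • u, fun v => ?_, ?_, ?_⟩
  · simp only [map_smul, LinearMap.smul_apply, smul_eq_mul, hu]
    ring
  · rw [bilin_smul_self, inv_pow, hsq, inv_mul_cancel₀ hpos.ne']
  · rw [h.deriv_smul_self, inv_pow, hsq, mul_inv_cancel_left₀ hpos.ne']

/-- The first eigenvalue of a block has a right derivative, the infimum of the derivative of
`a - μ b` over the normalized eigenvectors of the block. -/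
theorem exists_tendsto_first (h : PerturbedPair a b θ C a' b')
    (hE : EigenSystem (a 0) (b 0) e μ) {p : ℕ} {κ : ℝ → ℝ}
    (hκ : ∀ᶠ t in 𝓝[>] (0 : ℝ), ∃ e μ, EigenSystem (a t) (b t) e μ ∧ μ p = κ t)
    (hp : ∀ i < p, μ i < μ p) :
    ∃ m, Tendsto (fun t => (κ t - μ p) / t) (𝓝[>] 0) (𝓝 m) ∧
      ∀ u, (∀ v, a 0 u v = μ p * b 0 u v) → m * b 0 u u ≤ a' u - μ p * b' u := by
  set S : Set ℝ := {r | ∃ u, (∀ v, a 0 u v = μ p * b 0 u v) ∧ b 0 u u = 1 ∧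
    a' u - μ p * b' u = r} with hS
  have hne : S.Nonempty := ⟨_, e p, hE.eigen p, by simp [hE.ortho], rfl⟩
  have hbdd : BddBelow S := by
    refine ⟨-(C * (1 + |μ p|) * (μ p + θ)), ?_⟩
    rintro r ⟨u, hu, h1, rfl⟩
    exact (abs_le.mp (h.abs_deriv_le_of_eigen hu h1)).1
  have hle : ∀ u, (∀ v, a 0 u v = μ p * b 0 u v) →
      sInf S * b 0 u u ≤ a' u - μ p * b' u := by
    intro u hu
    rcases eq_or_ne u 0 with rfl | hu0
    · have := h.deriv_smul_self (μ p) 0 (0 : V)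
      rw [zero_smul] at this
      rw [this]
      simp
    · obtain ⟨w, hw, hw1, hwu⟩ := h.exists_normalize hu0 hu
      rw [hwu, mul_comm]
      exact mul_le_mul_of_nonneg_left (csInf_le hbdd ⟨w, hw, hw1, rfl⟩) (h.pair.b_nonneg u)
  refine ⟨sInf S, tendsto_div_of_eventually (fun c hc => ?_) (fun c hc => ?_), hle⟩
  · refine h.eventually_ge hκ (m := p) (fun i => e i) ⊥ (by simp) (μ := μ p) (c := sInf S)
      (fun w hw => hE.min p w fun i hi => congrFun ((Submodule.mem_bot ℝ).mp hw) ⟨i, hi⟩)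
      (fun w hw0 hw => hle w ?_) hc
    exact h.pair.eigen_of_min (k := p) (fun i _ j _ => hE.ortho i j) (fun i _ => hE.eigen i)
      (hE.min p) (fun i hi => congrFun ((Submodule.mem_bot ℝ).mp hw0) ⟨i, hi⟩) hw
  · obtain ⟨r, ⟨u, hu, hu1, hur⟩, hrc⟩ := exists_lt_of_csInf_lt hne hc
    have hlt : ∀ i < p + 1, ¬ i < p → i = p := fun i hi hip => by omega
    have hue : ∀ i < p, b 0 (e i) u = 0 := fun i hi =>
      hE.eigenvector_orthogonal h.pair hu (hp i hi).ne
    -- test with the lower eigenvectors and one eigenvector of the block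
    refine h.eventually_le hκ (f := fun i => if i < p then e i else u) (ν := μ) (μ := μ p)
      (c := r) ?_ ?_ (fun i hi => hE.mono (Nat.lt_succ_iff.mp hi)) ?_ hrc
    · intro i hi j hj
      by_cases hip : i < p <;> by_cases hjp : j < p
      · simp only [hip, hjp, if_true, hE.ortho]
      · have : i ≠ j := by omega
        simp only [hip, hjp, if_true, if_false, this, hue i hip]
      · have : i ≠ j := by omega
        simp only [hip, hjp, if_true, if_false, this, h.pair.symm_b u, hue j hjp]
      · have : i = j := by omega
        simp only [hjp, if_true, if_false, this, hu1]
    · intro i hi v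
      by_cases hip : i < p
      · simp only [hip, if_true, hE.eigen]
      · simp only [hlt i hi hip, lt_irrefl, if_false, hu]
    · intro z hz hz1
      have hz0 : ∀ i ∈ Finset.range p, z i = 0 := fun i hi =>
        hz i (by have := Finset.mem_range.mp hi; omega) (hp i (Finset.mem_range.mp hi)).ne
      have hsum : ∑ i ∈ Finset.range (p + 1), z i • (if i < p then e i else u) = z p • u := by
        rw [Finset.sum_range_succ, Finset.sum_eq_zero fun i hi => by rw [hz0 i hi, zero_smul]]
        simp
      rw [Finset.sum_range_succ, Finset.sum_eq_zero fun i hi => by rw [hz0 i hi]; norm_num,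
        zero_add] at hz1
      rw [hsum, h.deriv_smul_self, hz1, hur, one_mul]

/-- The last eigenvalue of a block has a right derivative, the supremum of the derivative of
`a - μ b` over the normalized eigenvectors of the block. -/
theorem exists_tendsto_last (h : PerturbedPair a b θ C a' b')
    (hE : EigenSystem (a 0) (b 0) e μ) {p : ℕ} {κ : ℝ → ℝ}
    (hκ : ∀ᶠ t in 𝓝[>] (0 : ℝ), ∃ e μ, EigenSystem (a t) (b t) e μ ∧ μ p = κ t)
    (hp : μ p < μ (p + 1)) :
    ∃ m, Tendsto (fun t => (κ t - μ p) / t) (𝓝[>] 0) (𝓝 m) ∧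
      ∀ u, (∀ v, a 0 u v = μ p * b 0 u v) → a' u - μ p * b' u ≤ m * b 0 u u := by
  set S : Set ℝ := {r | ∃ u, (∀ v, a 0 u v = μ p * b 0 u v) ∧ b 0 u u = 1 ∧
    a' u - μ p * b' u = r} with hS
  have hne : S.Nonempty := ⟨_, e p, hE.eigen p, by simp [hE.ortho], rfl⟩
  have hbdd : BddAbove S := by
    refine ⟨C * (1 + |μ p|) * (μ p + θ), ?_⟩
    rintro r ⟨u, hu, h1, rfl⟩
    exact (abs_le.mp (h.abs_deriv_le_of_eigen hu h1)).2
  have hle : ∀ u, (∀ v, a 0 u v = μ p * b 0 u v) →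
      a' u - μ p * b' u ≤ sSup S * b 0 u u := by
    intro u hu
    rcases eq_or_ne u 0 with rfl | hu0
    · have := h.deriv_smul_self (μ p) 0 (0 : V)
      rw [zero_smul] at this
      rw [this]
      simp
    · obtain ⟨w, hw, hw1, hwu⟩ := h.exists_normalize hu0 hu
      rw [hwu, mul_comm (sSup S)]
      exact mul_le_mul_of_nonneg_left (le_csSup hbdd ⟨w, hw, hw1, rfl⟩) (h.pair.b_nonneg u)
  refine ⟨sSup S, tendsto_div_of_eventually (fun c hc => ?_) (fun c hc => ?_), hle⟩
  · obtain ⟨r, ⟨u, hu, hu1, hur⟩, hrc⟩ := exists_lt_of_lt_csSup hne hc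
    have huS := hE.eigenvector_eq_sum h.pair hu hp
    set y : Fin (p + 1) → ℝ := fun i => b 0 (e i) u with hy
    have hy0 : y ≠ 0 := by
      intro h0
      have : u = 0 := by
        rw [huS]
        refine Finset.sum_eq_zero fun i hi => ?_
        have h1 : b 0 (e i) u = 0 := congrFun h0 ⟨i, Finset.mem_range.mp hi⟩
        rw [h1, zero_smul]
      rw [this] at hu1
      simp at hu1
    -- the constraints remove from the eigenvectors up to `μ p` all directions but `u`
    have key : ∀ w, (fun i : Fin (p + 1) => b 0 (e i) w) ∈ Submodule.span ℝ {y} →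
        ∃ s r, w = r + s • u ∧ a 0 w w = μ p * s ^ 2 + a 0 r r ∧ b 0 w w = s ^ 2 + b 0 r r ∧
          μ (p + 1) * b 0 r r ≤ a 0 r r := by
      intro w hw
      obtain ⟨s, hs⟩ := Submodule.mem_span_singleton.mp hw
      have hr : ∀ i < p + 1, b 0 (e i) (w - s • u) = 0 := by
        intro i hi
        have h1 : s * b 0 (e i) u = b 0 (e i) w := congrFun hs ⟨i, hi⟩
        simp [h1]
      have hub : b 0 (w - s • u) u = 0 := by
        conv_lhs => rw [huS]
        rw [bilin_sum_right]
        refine Finset.sum_eq_zero fun i hi => ?_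
        rw [h.pair.symm_b _ (e i), ← huS, hr i (Finset.mem_range.mp hi), mul_zero]
      have hw : w = (w - s • u) + s • u := by abel
      refine ⟨s, w - s • u, hw, ?_, ?_, hE.min (p + 1) _ hr⟩
      · conv_lhs => rw [hw]
        rw [bilin_add_smul_self h.pair.symm_a, h.pair.symm_a _ u, hu, h.pair.symm_b u, hub, hu, hu1]
        ring
      · conv_lhs => rw [hw]
        rw [bilin_add_smul_self h.pair.symm_b, hub, hu1]
        ring
    refine h.eventually_ge hκ (m := p + 1) (fun i => e i) (Submodule.span ℝ {y})
      (by rw [finrank_span_singleton hy0]) (μ := μ p) (c := r) (fun w hw => ?_)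
      (fun w hw hw' => ?_) hrc
    · obtain ⟨s, r, -, ha, hb, hr⟩ := key w hw
      rw [ha, hb]
      nlinarith [h.pair.b_nonneg r]
    · obtain ⟨s, r', hwr, ha, hb, hr⟩ := key w hw
      have hr0 : r' = 0 := by
        refine h.pair.eq_zero_of_b_nonpos ?_
        rw [ha, hb] at hw'
        nlinarith
      rw [hr0, zero_add] at hwr
      rw [hwr, h.deriv_smul_self, bilin_smul_self, hu1, hur]
      linarith
  · refine h.eventually_le hκ (f := e) (ν := μ) (μ := μ p) (c := sSup S)
      (fun i _ j _ => hE.ortho i j) (fun i _ => hE.eigen i)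
      (fun i hi => hE.mono (Nat.lt_succ_iff.mp hi)) (fun z hz hz1 => ?_) hc
    have h1 := hle _ (hE.eigen_sum hz)
    rwa [bilin_sum_orthonormal_self (fun i _ j _ => hE.ortho i j), hz1, mul_one] at h1

end PerturbedPair
end Blocks

/-! ### The forms of a family of Rayleigh quotients on a common domain -/

namespace RayleighFamily

section Forms

variable {X Y : Type*} [AddCommGroup Y] [Module ℝ Y] (D : RayleighFamily X Y)

open Classical in
/-- The bilinear form `Γ(y, ·, ·)` on a subspace `K` of its domain `H(y)`; it is `0` by convention
if `K` is not contained in `H(y)`. -/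
noncomputable def gForm (y : X) (K : Submodule ℝ Y) : LinearMap.BilinForm ℝ K :=
  if h : K ≤ D.H y then
    (1 / 2 : ℝ) • ((D.G y).comp (Submodule.inclusion h)).polarBilin else 0

/-- The bilinear form `B(y, ·, ·)` on a subspace `K`. -/
noncomputable def bForm (y : X) (K : Submodule ℝ Y) : LinearMap.BilinForm ℝ K :=
  (1 / 2 : ℝ) • ((D.Q y).comp K.subtype).polarBilin

theorem gForm_apply {y : X} {K : Submodule ℝ Y} (h : K ≤ D.H y) (u v : K) :
    D.gForm y K u v = D.Γ y u v := by
  have hu := h u.2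
  have hv := h v.2
  simp only [gForm, h, dif_pos, Γ, g, hu, hv, add_mem hu hv, LinearMap.smul_apply,
    QuadraticMap.polarBilin_apply_apply, QuadraticMap.polar, QuadraticMap.comp_apply, smul_eq_mul]
  have e : ∀ r s t : ℝ, 1 / 2 * (r - s - t) = (r - s - t) / 2 := fun r s t => by ring
  exact e _ _ _

theorem bForm_apply (y : X) (K : Submodule ℝ Y) (u v : K) :
    D.bForm y K u v = D.B y u v := by
  simp only [bForm, B, LinearMap.smul_apply,
    QuadraticMap.polarBilin_apply_apply, QuadraticMap.polar, QuadraticMap.comp_apply, smul_eq_mul,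
    Submodule.subtype_apply, Submodule.coe_add]
  ring

theorem B_self (y : X) (u : Y) : D.B y u u = D.Q y u := by
  have h := (D.Q y).map_smul 2 u
  rw [two_smul, smul_eq_mul] at h
  rw [B, h]
  ring

theorem B_comm (y : X) (u v : Y) : D.B y u v = D.B y v u := by
  rw [B, B, add_comm u v]
  ring

theorem Γ_comm (y : X) (u v : Y) : D.Γ y u v = D.Γ y v u := by
  rw [Γ, Γ, add_comm u v]
  ring

theorem Γ_self {y : X} {u : Y} (hu : u ∈ D.H y) : D.Γ y u u = D.g y u := by
  have h := (D.G y).map_smul 2 ⟨u, hu⟩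
  rw [two_smul, smul_eq_mul] at h
  simp only [Γ, g, hu, add_mem hu hu, dif_pos]
  rw [AddMemClass.mk_add_mk] at h
  rw [h]
  ring

theorem B_smul_left (y : X) (s : ℝ) (u v : Y) : D.B y (s • u) v = s * D.B y u v := by
  have h : ∀ w z : Y, D.B y w z = (1 / 2 : ℝ) * (D.Q y).polarBilin w z := fun w z => by
    rw [QuadraticMap.polarBilin_apply_apply, QuadraticMap.polar, B]
    ring
  rw [h, h, map_smul, LinearMap.smul_apply, smul_eq_mul]
  ring

theorem mem_eigenspace_iff_forms {y : X} {s : ℝ} {u : Y} :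
    u ∈ D.eigenspace y s ↔ ∃ w : D.H y, (w : Y) = u ∧
      ∀ v, D.gForm y (D.H y) w v = s * D.bForm y (D.H y) w v := by
  rw [D.mem_eigenspace]
  constructor
  · rintro ⟨hu, h⟩
    refine ⟨⟨u, hu⟩, rfl, fun v => ?_⟩
    rw [D.gForm_apply le_rfl, bForm_apply]
    exact h v v.2
  · rintro ⟨w, rfl, h⟩
    refine ⟨w.2, fun v hv => ?_⟩
    have := h ⟨v, hv⟩
    rwa [D.gForm_apply le_rfl, bForm_apply] at this

end Forms

section Eigenvalues

variable {X Y : Type*} [AddCommGroup Y] [Module ℝ Y] {D : RayleighFamily X Y}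

/-- The `(k + 1)`-st eigenvalue is the `k`-th member of any complete eigensystem. -/
theorem eigenvalue_eq {y : X} {θ : ℝ} {e : ℕ → D.H y} {μ : ℕ → ℝ}
    (h : CompactPair (D.gForm y (D.H y)) (D.bForm y (D.H y)) θ)
    (he : EigenSystem (D.gForm y (D.H y)) (D.bForm y (D.H y)) e μ) (k : ℕ) :
    D.eigenvalue (k + 1) y = μ k := by
  classical
  have hset : {t : ℝ | ((k + 1 : ℕ) : Cardinal) ≤
      Module.rank ℝ ↥(⨆ (s : ℝ) (_ : s ≤ t), D.eigenspace y s)} = Set.Ici (μ k) := by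
    ext t
    rw [Set.mem_ofPred_eq, Set.mem_Ici]
    constructor
    · intro hk
      by_contra! hlt
      have hsup : (⨆ (s : ℝ) (_ : s ≤ t), D.eigenspace y s)
          ≤ Submodule.span ℝ (((Finset.range k).image fun i => (e i : Y) : Finset Y) : Set Y) := by
        refine iSup₂_le fun s hs u hu => ?_
        obtain ⟨w, rfl, hw⟩ := D.mem_eigenspace_iff_forms.mp hu
        rw [he.eigenvector_eq_sum h hw (hs.trans_lt hlt), Submodule.coe_sum]
        refine Submodule.sum_mem _ fun i hi => Submodule.smul_mem _ _ (Submodule.subset_span ?_)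
        exact Finset.mem_coe.mpr (Finset.mem_image_of_mem (fun i => (e i : Y)) hi)
      have h1 := (hk.trans (Submodule.rank_mono hsup)).trans (rank_span_finset_le _)
      have h2 : k + 1 ≤ ((Finset.range k).image fun i => (e i : Y)).card := by exact_mod_cast h1
      have h3 := Finset.card_image_le (s := Finset.range k) (f := fun i => (e i : Y))
      rw [Finset.card_range] at h3
      omega
    · intro hkt
      have hmem : ∀ i : Fin (k + 1), (e i : Y) ∈ ⨆ (s : ℝ) (_ : s ≤ t), D.eigenspace y s := by
        intro i
        have hi : μ i ≤ t := (he.mono (Nat.lt_succ_iff.mp i.2)).trans hkt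
        exact Submodule.mem_iSup_of_mem (μ i) (Submodule.mem_iSup_of_mem hi
          (D.mem_eigenspace_iff_forms.mpr ⟨e i, rfl, he.eigen i⟩))
      have hli : LinearIndependent ℝ fun i : Fin (k + 1) => e i := by
        rw [Fintype.linearIndependent_iff]
        intro c hc i
        have h1 : D.bForm y (D.H y) (e i) (∑ j, c j • e j) = c i := by
          simp [map_sum, he.ortho, Fin.val_inj]
        rw [← h1, hc, map_zero]
      have hli' : LinearIndependent ℝ fun i : Fin (k + 1) =>
          (⟨e i, hmem i⟩ : ↥(⨆ (s : ℝ) (_ : s ≤ t), D.eigenspace y s)) := by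
        refine LinearIndependent.of_comp (Submodule.subtype _) ?_
        exact hli.map' (D.H y).subtype (Submodule.ker_subtype _)
      simpa using hli'.cardinal_lift_le_rank
  rw [eigenvalue, hset, csInf_Ici]

end Eigenvalues

section Standing

variable {X Y : Type*} [NormedAddCommGroup X] [NormedSpace ℝ X] [AddCommGroup Y] [Module ℝ Y]
  {D : RayleighFamily X Y} {Ω : Set X} {θ : X → ℝ} {x : X}

theorem StandingAt.compactPair (h : D.StandingAt Ω θ x) (hx : x ∈ Ω) :
    CompactPair (D.gForm x (D.H x)) (D.bForm x (D.H x)) (θ x) := by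
  have hpos : ∀ u ∈ D.H x, 0 ≤ D.g x u + θ x * D.Q x u := by
    intro u hu
    rcases eq_or_ne u 0 with rfl | hu0
    · have h1 : D.g x 0 = 0 := by
        rw [g, dif_pos hu]
        exact (D.G x).map_zero
      simp [h1]
    · exact (h.hilbert.self_of_nhds.pos u hu hu0).le
  refine ⟨fun u v => ?_, fun u v => ?_, fun u hu => ?_, fun u => ?_, fun u M hM => ?_⟩
  · rw [D.gForm_apply le_rfl, D.gForm_apply le_rfl, Γ_comm]
  · rw [bForm_apply, bForm_apply, B_comm]
  · rw [bForm_apply, B_self]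
    exact h.posDef u (by simpa using hu)
  · rw [D.gForm_apply le_rfl, bForm_apply, B_self, D.Γ_self u.2]
    exact hpos u u.2
  · obtain ⟨v, hv, s, hs, h1, h2⟩ := h.compact (fun _ => x) (fun n => u n) (fun _ => hx)
      tendsto_const_nhds (fun n => (u n).2) ⟨Real.sqrt M, fun n => by
        have := hM n
        rw [D.gForm_apply le_rfl, bForm_apply, B_self, D.Γ_self (u n).2] at this
        exact Real.sqrt_le_sqrt this⟩
    refine ⟨⟨v, hv⟩, s, hs, ?_, fun w => ?_⟩
    · refine h1.congr fun n => ?_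
      rw [bForm_apply, B_self]
      rfl
    · simp_rw [D.gForm_apply le_rfl]
      exact h2 w w.2

/-- A dense subspace of an infinite-dimensional space is infinite-dimensional. -/
theorem StandingAt.not_finiteDimensional (h : D.StandingAt Ω θ x)
    (hY : ¬ FiniteDimensional ℝ Y) : ¬ FiniteDimensional ℝ (D.H x) := by
  intro hfin
  obtain ⟨t, ht⟩ := (Submodule.fg_iff_finiteDimensional _).mpr hfin
  obtain ⟨u, hu0, hu⟩ := exists_ne_zero_orthogonal hY (D.Q x).polarBilin t.finite_toSet
  have hort : ∀ v ∈ D.H x, (D.Q x).polarBilin v u = 0 := by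
    intro v hv
    rw [← ht] at hv
    refine Submodule.span_induction (p := fun v _ => (D.Q x).polarBilin v u = 0) hu (by simp)
      (fun a b _ _ ha hb => by simp only [map_add, LinearMap.add_apply, ha, hb, add_zero])
      (fun s a _ ha => by simp only [map_smul, LinearMap.smul_apply, ha, smul_zero]) hv
  obtain ⟨v, hv, hlt⟩ := h.dense u _ (h.posDef u hu0)
  have h1 : D.Q x (u - v) = D.Q x u + D.Q x v := by
    have := hort (-v) (neg_mem hv)
    rw [QuadraticMap.polarBilin_apply_apply, QuadraticMap.polar, QuadraticMap.map_neg] at this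
    rw [sub_eq_neg_add]
    linarith
  have h2 : 0 ≤ D.Q x v := h.posDef.nonneg v
  linarith

/-- The eigenvalues are those of an eigensystem on `H(y)`; the equation `H(y) = K` lets the forms
at different points live on the same space. -/
theorem Standing.exists_eigenSystem (hD : D.Standing Ω) (hY : ¬ FiniteDimensional ℝ Y) {y : X}
    (hy : y ∈ Ω) {K : Submodule ℝ Y} (hK : D.H y = K) :
    ∃ e : ℕ → K, EigenSystem (D.gForm y K) (D.bForm y K) e (fun k => D.eigenvalue (k + 1) y) := by
  subst hK
  obtain ⟨θ, h⟩ := hD y hy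
  have hp := h.compactPair hy
  obtain ⟨e, μ, he⟩ := hp.exists_eigenSystem (h.not_finiteDimensional hY)
  refine ⟨e, ?_⟩
  rwa [show (fun k => D.eigenvalue (k + 1) y) = μ from funext fun k => eigenvalue_eq hp he k]

theorem tendsto_rightDeriv {f : X → ℝ} (hf : DifferentiableAt ℝ f x) (h : X) :
    Tendsto (fun t : ℝ => (f (x + t • h) - f x) / t) (𝓝[>] 0) (𝓝 (fderiv ℝ f x h)) := by
  have h1 : HasDerivAt (fun t : ℝ => f (x + t • h)) (fderiv ℝ f x h) 0 :=
    hf.hasFDerivAt.hasLineDerivAt h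
  refine h1.tendsto_slope_zero_right.congr fun t => ?_
  simp [div_eq_inv_mul]

theorem tendsto_ray (x h : X) : Tendsto (fun t : ℝ => x + t • h) (𝓝[>] 0) (𝓝 x) := by
  have : Continuous fun t : ℝ => x + t • h := by fun_prop
  exact (this.tendsto' 0 x (by simp)).mono_left nhdsWithin_le_nhds

/-- Along a ray the family of forms is differentiable from the right: the increments are
controlled by the bounds on the derivatives of the bilinear forms and the mean value
inequality. -/
theorem Standing.perturbedPair (hD : D.Standing Ω) (hΩ : IsOpen Ω) (hx : x ∈ Ω)
    (hst : D.StandingAt Ω θ x) (h : X) :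
    ∃ C, PerturbedPair (fun t => D.gForm (x + t • h) (D.H x))
      (fun t => D.bForm (x + t • h) (D.H x)) (θ x) C
      (fun u => fderiv ℝ (fun y => D.g y u) x h) (fun u => fderiv ℝ (fun y => D.Q y u) x h) := by
  obtain ⟨C₁, hC₁, heq⟩ := hst.equiv
  obtain ⟨C₀, hC₀, hder⟩ := hst.deriv_bound
  obtain ⟨r, hr, hball⟩ := Metric.eventually_nhds_iff_ball.mp
    ((heq.and hder).and (hΩ.mem_nhds hx))
  set K := C₀ * C₁ ^ 2 with hK
  have hN0 : ∀ (s : ℝ) (y : X) (u : Y), 0 ≤ D.N s y u := fun s y u => Real.sqrt_nonneg _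
  have hNle : ∀ y ∈ Metric.ball x r, ∀ u ∈ D.H x, ∀ v ∈ D.H x,
      C₀ * D.N (θ y) y u * D.N (θ y) y v ≤ K * (D.N (θ x) x u * D.N (θ x) x v) := by
    intro y hy u hu v hv
    have hle : ∀ u ∈ D.H x, D.N (θ y) y u ≤ C₁ * D.N (θ x) x u := by
      intro u hu
      have h1 := ((hball y hy).1.1.2 u hu).1
      rwa [inv_mul_le_iff₀ (by linarith)] at h1
    have h2 := mul_le_mul (hle u hu) (hle v hv) (hN0 _ _ _)
      (mul_nonneg (by linarith) (hN0 _ _ _))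
    have h3 := mul_le_mul_of_nonneg_left h2 hC₀.le
    rw [hK]
    linarith
  have hdQ : ∀ y ∈ Metric.ball x r, ∀ u, DifferentiableAt ℝ (fun z => D.Q z u) y := by
    intro y hy u
    obtain ⟨θ', hst'⟩ := hD y (hball y hy).2
    exact hst'.diff_Q u
  have hdG : ∀ y ∈ Metric.ball x r, ∀ u ∈ D.H x, DifferentiableAt ℝ (fun z => D.g z u) y := by
    intro y hy u hu
    obtain ⟨θ', hst'⟩ := hD y (hball y hy).2
    exact hst'.diff_G u (by rwa [(hball y hy).1.1.1])
  have hdB : ∀ u v, ∀ y ∈ Metric.ball x r, DifferentiableAt ℝ (fun z => D.B z u v) y := by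
    intro u v y hy
    simp only [B, div_eq_mul_inv]
    exact (((hdQ y hy (u + v)).fun_sub (hdQ y hy u)).fun_sub (hdQ y hy v)).mul_const _
  have hdΓ : ∀ u ∈ D.H x, ∀ v ∈ D.H x, ∀ y ∈ Metric.ball x r,
      DifferentiableAt ℝ (fun z => D.Γ z u v) y := by
    intro u hu v hv y hy
    simp only [Γ, div_eq_mul_inv]
    exact (((hdG y hy (u + v) (add_mem hu hv)).fun_sub (hdG y hy u hu)).fun_sub
      (hdG y hy v hv)).mul_const _
  have hxb : x ∈ Metric.ball x r := Metric.mem_ball_self hr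
  have hray : ∀ᶠ t in 𝓝[>] (0 : ℝ), x + t • h ∈ Metric.ball x r :=
    (tendsto_ray x h).eventually (Metric.ball_mem_nhds x hr)
  have hnorm : ∀ t : ℝ, 0 < t → ‖x + t • h - x‖ = ‖h‖ * t := by
    intro t ht
    rw [add_sub_cancel_left, norm_smul, Real.norm_eq_abs, abs_of_pos ht, mul_comm]
  have hle : ∀ y ∈ Metric.ball x r, D.H x ≤ D.H y := fun y hy => (hball y hy).1.1.1.ge
  have hx0 : x + (0 : ℝ) • h = x := by simp
  have hform : ∀ u : D.H x, formNorm (D.gForm x (D.H x)) (D.bForm x (D.H x)) (θ x) u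
      = D.N (θ x) x u := by
    intro u
    rw [formNorm, N, D.gForm_apply le_rfl, bForm_apply, B_self, D.Γ_self u.2]
  refine ⟨K * ‖h‖, ?_, by positivity, ?_, ⟨?_, ?_⟩, ⟨?_, ?_⟩⟩
  · rw [hx0]
    exact hst.compactPair hx
  · filter_upwards [hray] with t ht u
    obtain ⟨θ', hst'⟩ := hD _ (hball _ ht).2
    rw [bForm_apply, B_self]
    exact hst'.posDef.nonneg _
  · filter_upwards [hray, self_mem_nhdsWithin] with t ht h0 u v
    have h0 : 0 < t := h0
    rw [hx0, hform, hform, D.gForm_apply (hle _ ht), D.gForm_apply le_rfl]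
    have := (convex_ball x r).norm_image_sub_le_of_norm_fderiv_le (𝕜 := ℝ)
      (hdΓ u u.2 v v.2) (C := K * (D.N (θ x) x u * D.N (θ x) x v)) (fun y hy =>
        ((hball y hy).1.2 u (hle y hy u.2) v (hle y hy v.2)).2.trans
          (hNle y hy u u.2 v v.2)) hxb ht
    rw [hnorm t h0, Real.norm_eq_abs] at this
    linarith
  · intro u
    refine (tendsto_rightDeriv (hst.diff_G u u.2) h).congr' ?_
    filter_upwards [hray] with t ht
    rw [hx0, D.gForm_apply (hle _ ht), D.gForm_apply le_rfl, D.Γ_self (hle _ ht u.2), D.Γ_self u.2]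
  · filter_upwards [hray, self_mem_nhdsWithin] with t ht h0 u v
    have h0 : 0 < t := h0
    rw [hx0, hform, hform, D.bForm_apply, D.bForm_apply]
    have := (convex_ball x r).norm_image_sub_le_of_norm_fderiv_le (𝕜 := ℝ)
      (hdB u v) (C := K * (D.N (θ x) x u * D.N (θ x) x v)) (fun y hy =>
        ((hball y hy).1.2 u (hle y hy u.2) v (hle y hy v.2)).1.trans
          (hNle y hy u u.2 v v.2)) hxb ht
    rw [hnorm t h0, Real.norm_eq_abs] at this
    linarith
  · intro u
    refine (tendsto_rightDeriv (hst.diff_Q u) h).congr fun t => ?_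
    rw [hx0, bForm_apply, bForm_apply, B_self, B_self]

/-- On an eigenvector, the derivative of the Rayleigh quotient is that of `G - μ Q`. -/
theorem StandingAt.fderiv_rayleigh (hst : D.StandingAt Ω θ x) {μ : ℝ} {u : Y}
    (hu : u ∈ D.eigenspace x μ) (hu0 : u ≠ 0) (h : X) :
    D.Q x u * fderiv ℝ (fun y => D.rayleigh y u) x h
      = fderiv ℝ (fun y => D.g y u) x h - μ * fderiv ℝ (fun y => D.Q y u) x h := by
  obtain ⟨huH, hΓ⟩ := (D.mem_eigenspace x μ u).mp hu
  have hg : D.g x u = μ * D.Q x u := by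
    have := hΓ u huH
    rwa [D.Γ_self huH, B_self] at this
  have hQ : D.Q x u ≠ 0 := (hst.posDef u hu0).ne'
  have hdg := hst.diff_G u huH
  have hdQ := hst.diff_Q u
  have h1 : HasDerivAt (fun t : ℝ => D.g (x + t • h) u) _ 0 := hdg.hasFDerivAt.hasLineDerivAt h
  have h2 : HasDerivAt (fun t : ℝ => D.Q (x + t • h) u) _ 0 := hdQ.hasFDerivAt.hasLineDerivAt h
  have hd : DifferentiableAt ℝ (fun y => D.g y u / D.Q y u) x := by
    simp only [div_eq_mul_inv]
    exact hdg.fun_mul (hdQ.fun_inv hQ)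
  have h3 : HasDerivAt (fun t : ℝ => D.rayleigh (x + t • h) u) _ 0 :=
    hd.hasFDerivAt.hasLineDerivAt h
  have h4 := h3.unique (h1.div h2 (by simpa using hQ))
  have h5 : fderiv ℝ (fun y => D.rayleigh y u) x h = _ := h4
  rw [h5]
  simp only [zero_smul, add_zero, hg]
  field_simp

/-- The one-sided behaviour of the eigenvalues along a ray: they are Lipschitz, and the first and
the last eigenvalue of a block of equal eigenvalues have right derivatives that bound from below,
respectively from above, the derivatives of the Rayleigh quotients of all eigenvectors. -/
theorem Standing.eigenvalue_ray (hD : D.Standing Ω) (hΩ : IsOpen Ω)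
    (hY : ¬ FiniteDimensional ℝ Y) (hx : x ∈ Ω) (h : X) (p : ℕ) :
    (∃ L, ∀ᶠ t in 𝓝[>] (0 : ℝ),
      |D.eigenvalue (p + 1) (x + t • h) - D.eigenvalue (p + 1) x| ≤ L * t) ∧
    ((∀ i < p, D.eigenvalue (i + 1) x < D.eigenvalue (p + 1) x) →
      ∃ m, HasRightDirDeriv (D.eigenvalue (p + 1)) x h m ∧
        ∀ u ∈ D.E (p + 1) x, u ≠ 0 → m ≤ fderiv ℝ (fun y => D.rayleigh y u) x h) ∧
    (D.eigenvalue (p + 1) x < D.eigenvalue (p + 2) x →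
      ∃ m, HasRightDirDeriv (D.eigenvalue (p + 1)) x h m ∧
        ∀ u ∈ D.E (p + 1) x, u ≠ 0 → fderiv ℝ (fun y => D.rayleigh y u) x h ≤ m) := by
  obtain ⟨θ, hst⟩ := hD x hx
  obtain ⟨C, hP⟩ := hD.perturbedPair hΩ hx hst h
  obtain ⟨e, hE⟩ := hD.exists_eigenSystem hY hx rfl
  have hx0 : x + (0 : ℝ) • h = x := by simp
  have hE0 : EigenSystem (D.gForm (x + (0 : ℝ) • h) (D.H x)) (D.bForm (x + (0 : ℝ) • h) (D.H x)) e
      (fun k => D.eigenvalue (k + 1) x) := by rwa [hx0]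
  obtain ⟨C₁, -, heq⟩ := hst.equiv
  have hκ : ∀ᶠ t in 𝓝[>] (0 : ℝ), ∃ e μ, EigenSystem (D.gForm (x + t • h) (D.H x))
      (D.bForm (x + t • h) (D.H x)) e μ ∧ μ p = D.eigenvalue (p + 1) (x + t • h) := by
    filter_upwards [(tendsto_ray x h).eventually (heq.and (hΩ.mem_nhds hx))] with t ht
    obtain ⟨e, he⟩ := hD.exists_eigenSystem hY ht.2 ht.1.1
    exact ⟨e, _, he, rfl⟩
  have hform : ∀ u ∈ D.E (p + 1) x, ∃ w : D.H x, (w : Y) = u ∧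
      (∀ v, D.gForm (x + (0 : ℝ) • h) (D.H x) w v
        = D.eigenvalue (p + 1) x * D.bForm (x + (0 : ℝ) • h) (D.H x) w v) ∧
      D.bForm (x + (0 : ℝ) • h) (D.H x) w w = D.Q x u := by
    intro u hu
    obtain ⟨w, rfl, hw⟩ := D.mem_eigenspace_iff_forms.mp hu
    rw [hx0]
    exact ⟨w, rfl, hw, by rw [bForm_apply, B_self]⟩
  refine ⟨hP.eventually_abs_sub_le hE0 hκ, fun hp => ?_, fun hp => ?_⟩
  · obtain ⟨m, hm, hmu⟩ := hP.exists_tendsto_first hE0 hκ hp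
    refine ⟨m, hm, fun u hu hu0 => ?_⟩
    obtain ⟨w, rfl, hw, hwQ⟩ := hform u hu
    have h1 := hmu w hw
    rw [hwQ, ← hst.fderiv_rayleigh hu hu0, mul_comm] at h1
    exact le_of_mul_le_mul_left h1 (hst.posDef _ hu0)
  · obtain ⟨m, hm, hmu⟩ := hP.exists_tendsto_last hE0 hκ hp
    refine ⟨m, hm, fun u hu hu0 => ?_⟩
    obtain ⟨w, rfl, hw, hwQ⟩ := hform u hu
    have h1 := hmu w hw
    rw [hwQ, ← hst.fderiv_rayleigh hu hu0, mul_comm m] at h1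
    exact le_of_mul_le_mul_left h1 (hst.posDef _ hu0)

end Standing

end RayleighFamily

/-! ### Directional derivatives and Clarke critical points -/

section Directional

variable {X : Type*} [NormedAddCommGroup X] [NormedSpace ℝ X]

/-- The `liminf` may be bounded by its restriction to the fixed base point `y = x`. -/
theorem zero_mem_clarkeSuperdifferential {f : X → ℝ} {x : X}
    (h : (0 : X →L[ℝ] ℝ) ∈ superdifferential f x) :
    (0 : X →L[ℝ] ℝ) ∈ clarkeSuperdifferential f x := by
  intro v
  obtain ⟨ℓ, hℓ, hle⟩ := h v
  have hlim := (continuous_coe_real_ereal.tendsto ℓ).comp hℓ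
  have hT : Tendsto (fun t : ℝ => (x, t)) (𝓝[>] 0) (𝓝 x ×ˢ 𝓝[>] (0 : ℝ)) :=
    tendsto_const_nhds.prodMk tendsto_id
  calc clarkeLower f x v ≤ liminf (fun p : X × ℝ =>
        (((f (p.1 + p.2 • v) - f p.1) / p.2 : ℝ) : EReal)) (map (fun t : ℝ => (x, t)) (𝓝[>] 0)) :=
        liminf_le_liminf_of_le hT
    _ = ℓ := hlim.liminf_eq
    _ ≤ _ := EReal.coe_le_coe_iff.mpr hle

theorem zero_mem_clarkeSubdifferential {f : X → ℝ} {x : X}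
    (h : (0 : X →L[ℝ] ℝ) ∈ subdifferential f x) :
    (0 : X →L[ℝ] ℝ) ∈ clarkeSubdifferential f x := by
  intro v
  obtain ⟨ℓ, hℓ, hle⟩ := h v
  have hlim := (continuous_coe_real_ereal.tendsto ℓ).comp hℓ
  have hT : Tendsto (fun t : ℝ => (x, t)) (𝓝[>] 0) (𝓝 x ×ˢ 𝓝[>] (0 : ℝ)) :=
    tendsto_const_nhds.prodMk tendsto_id
  calc _ ≤ (ℓ : EReal) := EReal.coe_le_coe_iff.mpr hle
    _ = limsup (fun p : X × ℝ =>
        (((f (p.1 + p.2 • v) - f p.1) / p.2 : ℝ) : EReal)) (map (fun t : ℝ => (x, t)) (𝓝[>] 0)) :=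
        hlim.limsup_eq.symm
    _ ≤ clarkeUpper f x v := limsup_le_limsup_of_le hT

theorem tendsto_zero_of_isBigO_id {f : ℝ → ℝ}
    (hf : f =O[𝓝[>] 0] fun t : ℝ => t) : Tendsto f (𝓝[>] 0) (𝓝 0) :=
  hf.trans_tendsto (tendsto_id.mono_left nhdsWithin_le_nhds)

theorem HasRightDirDeriv.isBigO {f : X → ℝ} {x h : X} {ℓ : ℝ} (hf : HasRightDirDeriv f x h ℓ) :
    (fun t : ℝ => f (x + t • h) - f x) =O[𝓝[>] 0] fun t : ℝ => t := by
  refine ((hf.isBigO_one ℝ).mul (Asymptotics.isBigO_refl (fun t : ℝ => t) (𝓝[>] 0))).congr'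
    ?_ (Eventually.of_forall fun t => one_mul t)
  filter_upwards [self_mem_nhdsWithin] with t ht
  exact div_mul_cancel₀ _ (ne_of_gt ht)

/-- Chain rule for right directional derivatives. The components along which the outer derivative
vanishes need only be Lipschitz along the ray. -/
theorem hasRightDirDeriv_comp {N : ℕ} {F : (Fin N → ℝ) → ℝ} {v : X → Fin N → ℝ} {x h : X}
    {d L : Fin N → ℝ} (hF : DifferentiableAt ℝ F (v x))
    (hd : ∀ i, fderiv ℝ F (v x) (Pi.single i 1) = d i)
    (hlip : ∀ i, (fun t : ℝ => v (x + t • h) i - v x i) =O[𝓝[>] 0] fun t : ℝ => t)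
    (hL : ∀ i, d i ≠ 0 → HasRightDirDeriv (fun y => v y i) x h (L i)) :
    HasRightDirDeriv (fun y => F (v y)) x h (∑ i, d i * L i) := by
  have hO : (fun t : ℝ => v (x + t • h) - v x) =O[𝓝[>] 0] fun t : ℝ => t :=
    Asymptotics.isBigO_pi.mpr hlip
  have hv : Tendsto (fun t : ℝ => v (x + t • h)) (𝓝[>] 0) (𝓝 (v x)) := by
    refine tendsto_pi_nhds.mpr fun i => ?_
    simpa using (tendsto_zero_of_isBigO_id (hlip i)).add_const (v x i)
  have ho := (hF.hasFDerivAt.isLittleO.comp_tendsto hv).trans_isBigO hO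
  have h1 := ho.tendsto_div_nhds_zero
  have h2 : Tendsto (fun t : ℝ => ∑ i, d i * ((v (x + t • h) i - v x i) / t)) (𝓝[>] 0)
      (𝓝 (∑ i, d i * L i)) := by
    refine tendsto_finsetSum _ fun i _ => ?_
    by_cases hi : d i = 0
    · simp [hi]
    · exact (hL i hi).const_mul _
  have h3 := h1.add h2
  rw [zero_add] at h3
  refine h3.congr fun t => ?_
  have hsum : ∀ w : Fin N → ℝ, fderiv ℝ F (v x) w = ∑ i, w i * d i := by
    intro w
    have := LinearMap.pi_apply_eq_sum_univ (fderiv ℝ F (v x)).toLinearMap w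
    simp only [ContinuousLinearMap.coe_coe, smul_eq_mul] at this
    rw [this]
    refine Finset.sum_congr rfl fun i _ => ?_
    rw [← hd i]
    congr 2
    ext j
    simp [Pi.single_apply, eq_comm]
  simp only [Function.comp, hsum]
  rw [sub_div, Finset.sum_div, sub_add, ← Finset.sum_sub_distrib, Finset.sum_eq_zero, sub_zero]
  intro i _
  rw [Pi.sub_apply]
  ring

theorem isBigO_mul_ray {f g : X → ℝ} {x h : X}
    (hf : (fun t : ℝ => f (x + t • h) - f x) =O[𝓝[>] 0] fun t : ℝ => t)
    (hg : (fun t : ℝ => g (x + t • h) - g x) =O[𝓝[>] 0] fun t : ℝ => t) :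
    (fun t : ℝ => f (x + t • h) * g (x + t • h) - f x * g x) =O[𝓝[>] 0] fun t : ℝ => t := by
  have hgb : (fun t : ℝ => g (x + t • h)) =O[𝓝[>] 0] fun _ : ℝ => (1 : ℝ) := by
    have := (tendsto_zero_of_isBigO_id hg).add_const (g x)
    simp only [sub_add_cancel] at this
    exact this.isBigO_one ℝ
  refine (((hf.mul hgb).congr_right fun t => mul_one t).add (hg.const_mul_left (f x))).congr_left
    fun t => ?_
  ring

theorem HasRightDirDeriv.mul {f g : X → ℝ} {x h : X} {l m : ℝ}
    (hf : HasRightDirDeriv f x h l) (hg : HasRightDirDeriv g x h m) :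
    HasRightDirDeriv (fun y => f y * g y) x h (l * g x + f x * m) := by
  have hgc : Tendsto (fun t : ℝ => g (x + t • h)) (𝓝[>] 0) (𝓝 (g x)) := by
    simpa using (tendsto_zero_of_isBigO_id hg.isBigO).add_const (g x)
  refine ((Tendsto.mul hf hgc).add (Tendsto.const_mul (f x) hg)).congr fun t => ?_
  ring

end Directional

/-! ### Distribution of weights over the ends of the blocks -/

section Weights

variable {l N : ℕ}

theorem sum_fiber_mul (δ : Fin l → ℝ) (p : Fin l → Fin N) (z : Fin N → ℝ) :
    ∑ i, (∑ j with p j = i, δ j) * z i = ∑ j, δ j * z (p j) := by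
  rw [← Finset.sum_fiberwise (s := Finset.univ) (g := p)]
  refine Finset.sum_congr rfl fun i _ => ?_
  rw [Finset.sum_mul]
  refine Finset.sum_congr rfl fun j hj => ?_
  rw [(Finset.mem_filter.mp hj).2]

variable {δ : Fin l → ℝ} {A B : Fin l → Fin N}

theorem exists_of_weight_pos {i : Fin N}
    (hi : 0 < ∑ j with (if 0 ≤ δ j then A j else B j) = i, δ j) : ∃ j, A j = i := by
  obtain ⟨j, hj, hpos⟩ := Finset.exists_lt_of_sum_lt (f := fun _ => (0 : ℝ)) (by simpa using hi)
  have := (Finset.mem_filter.mp hj).2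
  rw [if_pos hpos.le] at this
  exact ⟨j, this⟩

theorem exists_of_weight_neg {i : Fin N}
    (hi : ∑ j with (if 0 ≤ δ j then A j else B j) = i, δ j < 0) : ∃ j, B j = i := by
  obtain ⟨j, hj, hneg⟩ := Finset.exists_lt_of_sum_lt (g := fun _ => (0 : ℝ)) (by simpa using hi)
  have := (Finset.mem_filter.mp hj).2
  rw [if_neg (not_le.mpr hneg)] at this
  exact ⟨j, this⟩

/-- If nonnegative weights are sent to one end of a block and negative weights to the other end,
there is no cancellation. -/
theorem weight_eq_zero {j₀ : Fin l} (hAB : A j₀ ≠ B j₀)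
    (hA : ∀ j, A j = A j₀ → B j = B j₀) (hB : ∀ j, B j = B j₀ → A j = A j₀)
    (hAB' : ∀ j, B j = A j₀ → A j = A j₀) (hBA' : ∀ j, A j = B j₀ → B j = B j₀)
    (h1 : ∑ j with (if 0 ≤ δ j then A j else B j) = A j₀, δ j = 0)
    (h2 : ∑ j with (if 0 ≤ δ j then A j else B j) = B j₀, δ j = 0) : δ j₀ = 0 := by
  rcases le_or_gt 0 (δ j₀) with h0 | h0
  · refine (Finset.sum_eq_zero_iff_of_nonneg fun j hj => ?_).mp h1 j₀ (by simp [h0])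
    by_contra hneg
    have hj := (Finset.mem_filter.mp hj).2
    rw [if_neg hneg] at hj
    exact hAB (hj.symm.trans (hA j (hAB' j hj)))
  · refine (Finset.sum_eq_zero_iff_of_nonpos fun j hj => ?_).mp h2 j₀ (by simp [h0.not_ge])
    by_contra hpos
    have hj := (Finset.mem_filter.mp hj).2
    rw [if_pos (not_le.mp hpos).le] at hj
    exact hAB ((hB j (hBA' j hj)).symm.trans hj)

end Weights

/-! ### Blocks of equal eigenvalues -/

namespace RayleighFamily

section Blocks

variable {X Y : Type*} [AddCommGroup Y] [Module ℝ Y] {x : X}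

theorem exists_first_index (D : RayleighFamily X Y) (x : X) {k : ℕ} (hk : 1 ≤ k)
    (hmono : ∀ p q, p ≤ q → D.eigenvalue (p + 1) x ≤ D.eigenvalue (q + 1) x) :
    ∃ p, D.eigenvalue (p + 1) x = D.eigenvalue k x ∧
      ∀ i < p, D.eigenvalue (i + 1) x < D.eigenvalue (p + 1) x := by
  classical
  have hex : ∃ p, D.eigenvalue (p + 1) x = D.eigenvalue k x := ⟨k - 1, by rw [Nat.sub_add_cancel hk]⟩
  refine ⟨Nat.find hex, Nat.find_spec hex, fun i hi => ?_⟩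
  refine lt_of_le_of_ne (hmono _ _ hi.le) fun h => Nat.find_min hex hi ?_
  rw [h, Nat.find_spec hex]

/-- On a line the normalized squares `B(u, ·)² / Q(u)` all agree. -/
theorem B_sq_div_Q_smul (D : RayleighFamily X Y) {e : Y} (he : D.Q x e = 1) {c : ℝ}
    (hc : c • e ≠ 0) (u : Y) : D.B x (c • e) u ^ 2 / D.Q x (c • e) = D.B x e u ^ 2 := by
  have hc0 : c ≠ 0 := fun h => hc (by rw [h, zero_smul])
  rw [B_smul_left, QuadraticMap.map_smul, he, smul_eq_mul]
  field_simp

end Blocks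

variable {X Y : Type*} [NormedAddCommGroup X] [NormedSpace ℝ X] [AddCommGroup Y] [Module ℝ Y]
  {D : RayleighFamily X Y} {Ω : Set X} {x : X}

theorem Standing.eigenvalue_mono (hD : D.Standing Ω) (hY : ¬ FiniteDimensional ℝ Y)
    (hx : x ∈ Ω) {p q : ℕ} (hpq : p ≤ q) : D.eigenvalue (p + 1) x ≤ D.eigenvalue (q + 1) x := by
  obtain ⟨e, he⟩ := hD.exists_eigenSystem hY hx rfl
  exact he.mono hpq

theorem Standing.exists_last_index (hD : D.Standing Ω) (hY : ¬ FiniteDimensional ℝ Y)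
    (hx : x ∈ Ω) {k : ℕ} (hk : 1 ≤ k) :
    ∃ p, D.eigenvalue (p + 1) x = D.eigenvalue k x ∧
      D.eigenvalue (p + 1) x < D.eigenvalue (p + 2) x := by
  classical
  obtain ⟨e, he⟩ := hD.exists_eigenSystem hY hx rfl
  have hex := he.unbounded (D.eigenvalue k x)
  obtain ⟨k, rfl⟩ : ∃ k', k = k' + 1 := ⟨k - 1, by omega⟩
  have hlt : k < Nat.find hex := by
    by_contra! hle
    exact absurd (Nat.find_spec hex) (not_lt.mpr (he.mono hle))
  obtain ⟨p, hp⟩ : ∃ p, Nat.find hex = p + 1 := ⟨Nat.find hex - 1, by omega⟩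
  have h1 : D.eigenvalue (p + 1) x = D.eigenvalue (k + 1) x := by
    refine le_antisymm (not_lt.mp (Nat.find_min hex (m := p) (by omega))) ?_
    exact hD.eigenvalue_mono hY hx (by omega)
  refine ⟨p, h1, ?_⟩
  have h2 := Nat.find_spec hex
  rw [hp] at h2
  rw [h1]
  exact h2

/-- The eigenspace of a simple eigenvalue is a line. -/
theorem Standing.exists_span_of_simple (hD : D.Standing Ω) (hY : ¬ FiniteDimensional ℝ Y)
    (hx : x ∈ Ω) {p : ℕ} (hfirst : ∀ i < p, D.eigenvalue (i + 1) x < D.eigenvalue (p + 1) x)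
    (hlast : D.eigenvalue (p + 1) x < D.eigenvalue (p + 2) x) :
    ∃ e : Y, D.Q x e = 1 ∧ ∀ u ∈ D.E (p + 1) x, ∃ c : ℝ, u = c • e := by
  obtain ⟨e, he⟩ := hD.exists_eigenSystem hY hx rfl
  obtain ⟨θ, hst⟩ := hD x hx
  have hpair := hst.compactPair hx
  refine ⟨e p, ?_, fun u hu => ?_⟩
  · rw [← B_self, ← bForm_apply, he.ortho, if_pos rfl]
  · obtain ⟨w, rfl, hw⟩ := D.mem_eigenspace_iff_forms.mp hu
    refine ⟨D.bForm x (D.H x) (e p) w, ?_⟩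
    have h1 := he.eigenvector_eq_sum hpair hw hlast
    rw [Finset.sum_range_succ, Finset.sum_eq_zero fun i hi => by
      rw [he.eigenvector_orthogonal hpair hw (hfirst i (Finset.mem_range.mp hi)).ne, zero_smul],
      zero_add] at h1
    exact congrArg Subtype.val h1

/-- The derivative of `F (sc λ₁, …, sc λ_N)` along a ray, when the gradient of `F` distributes the
weights `δ j` over eigenvalues that equal those of the `φ j` at `x`: by the Euler–Lagrange
equation only the gap between the derivatives of the eigenvalues and those of the Rayleigh
quotients remains. -/
theorem Standing.hasRightDirDeriv_comp_eigenvalue (hD : D.Standing Ω)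
    (hY : ¬ FiniteDimensional ℝ Y) (hΩ : IsOpen Ω) (hx : x ∈ Ω) {sc : X → ℝ}
    (hsc_pos : 0 < sc x) (hsc : DifferentiableAt ℝ sc x) {l : ℕ} {k : Fin l → ℕ}
    {φ : Fin l → Y} {δ : Fin l → ℝ}
    (hEL : ∑ j, δ j • fderiv ℝ (fun y => D.rayleigh y (φ j)) x
      + ((∑ j, δ j * D.eigenvalue (k j) x) / sc x) • fderiv ℝ sc x = 0)
    {N : ℕ} {p : Fin l → Fin N} (hp : ∀ j, D.eigenvalue (p j + 1) x = D.eigenvalue (k j) x)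
    {h : X} {m : Fin l → ℝ} (hm : ∀ j, HasRightDirDeriv (D.eigenvalue (p j + 1)) x h (m j))
    {F : (Fin N → ℝ) → ℝ} (hF : ContDiff ℝ 1 F)
    (hd : ∀ i, fderiv ℝ F (fun n => sc x * D.eigenvalue (n + 1) x) (Pi.single i 1)
      = ∑ j with p j = i, δ j) :
    HasRightDirDeriv (fun y => F (fun n => sc y * D.eigenvalue (n + 1) y)) x h
      (sc x * ∑ j, δ j * (m j - fderiv ℝ (fun y => D.rayleigh y (φ j)) x h)) := by
  classical
  have hscd : HasRightDirDeriv sc x h (fderiv ℝ sc x h) := tendsto_rightDeriv hsc h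
  have hlip : ∀ i : Fin N, (fun t : ℝ => D.eigenvalue (i + 1) (x + t • h)
      - D.eigenvalue (i + 1) x) =O[𝓝[>] 0] fun t : ℝ => t := by
    intro i
    obtain ⟨K, hK⟩ := (hD.eigenvalue_ray hΩ hY hx h i).1
    refine Asymptotics.IsBigO.of_bound K ?_
    filter_upwards [hK, self_mem_nhdsWithin] with t ht h0
    have h0 : 0 < t := h0
    rwa [Real.norm_eq_abs, Real.norm_eq_abs, abs_of_pos h0]
  set L : Fin N → ℝ := fun i =>
    if hi : ∃ ℓ, HasRightDirDeriv (D.eigenvalue (i + 1)) x h ℓ then hi.choose else 0 with hLdef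
  have hL : ∀ i : Fin N, (∃ ℓ, HasRightDirDeriv (D.eigenvalue (i + 1)) x h ℓ) →
      HasRightDirDeriv (D.eigenvalue (i + 1)) x h (L i) := by
    intro i hi
    simp only [hLdef, dif_pos hi]
    exact hi.choose_spec
  have hLp : ∀ j, L (p j) = m j := fun j => tendsto_nhds_unique (hL _ ⟨_, hm j⟩) (hm j)
  have hmain := hasRightDirDeriv_comp (v := fun y n => sc y * D.eigenvalue (n + 1) y) (x := x)
    (h := h) (L := fun i => fderiv ℝ sc x h * D.eigenvalue (i + 1) x + sc x * L i)
    (hF.differentiable one_ne_zero _) hd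
    (fun i => isBigO_mul_ray hscd.isBigO (hlip i)) (fun i hi => ?_)
  · convert hmain using 1
    rw [sum_fiber_mul δ p]
    simp only [hLp, hp]
    have hEL' := congrArg (fun ζ : X →L[ℝ] ℝ => ζ h) hEL
    simp only [add_apply, sum_apply,
      smul_apply, smul_eq_mul, zero_apply] at hEL'
    have h1 : sc x * ∑ j, δ j * fderiv ℝ (fun y => D.rayleigh y (φ j)) x h
        + (∑ j, δ j * D.eigenvalue (k j) x) * fderiv ℝ sc x h = 0 := by
      have := congrArg (fun r => sc x * r) hEL'
      simp only [mul_add, mul_zero] at this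
      rw [← this]
      field_simp
    simp only [mul_sub, mul_add, Finset.sum_sub_distrib, Finset.sum_add_distrib]
    have h2 : ∑ j, δ j * (fderiv ℝ sc x h * D.eigenvalue (k j) x)
        = (∑ j, δ j * D.eigenvalue (k j) x) * fderiv ℝ sc x h := by
      rw [Finset.sum_mul]
      exact Finset.sum_congr rfl fun j _ => by ring
    have h3 : ∑ j, δ j * (sc x * m j) = sc x * ∑ j, δ j * m j := by
      rw [Finset.mul_sum]
      exact Finset.sum_congr rfl fun j _ => by ring
    rw [h2, h3]
    linarith
  · refine hscd.mul (hL i ?_)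
    by_contra hno
    refine hi (Finset.sum_eq_zero fun j hj => ?_)
    exact absurd ⟨m j, (Finset.mem_filter.mp hj).2 ▸ hm j⟩ hno

/-- The weights obtained by sending each `δ j` to one end of its block, `A j` or `B j` according to
its sign, have the same total on every block as the `δ j`, and they vanish on a block only if the
quadratic form `∑ δ j B(φ j, ·)² / Q(φ j)` of the block does. -/
theorem Standing.weights_on_block (hD : D.Standing Ω) (hY : ¬ FiniteDimensional ℝ Y)
    (hx : x ∈ Ω) {l : ℕ} {k : Fin l → ℕ} {φ : Fin l → Y} (hφ : ∀ j, φ j ∈ D.E (k j) x)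
    (hφ0 : ∀ j, φ j ≠ 0) {δ : Fin l → ℝ} {N : ℕ} {A B : Fin l → Fin N}
    (hA : ∀ j, D.eigenvalue (A j + 1) x = D.eigenvalue (k j) x)
    (hB : ∀ j, D.eigenvalue (B j + 1) x = D.eigenvalue (k j) x)
    (hAeq : ∀ j j', D.eigenvalue (k j) x = D.eigenvalue (k j') x → A j = A j')
    (hBeq : ∀ j j', D.eigenvalue (k j) x = D.eigenvalue (k j') x → B j = B j')
    (hAB : ∀ j, A j = B j → (∀ i < (A j : ℕ), D.eigenvalue (i + 1) x < D.eigenvalue (A j + 1) x) ∧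
      D.eigenvalue (A j + 1) x < D.eigenvalue (A j + 2) x) (μ : ℝ) :
    ∑ i ∈ Finset.univ.filter (fun i : Fin N => D.eigenvalue (i + 1) x = μ),
        (∑ j with (if 0 ≤ δ j then A j else B j) = i, δ j)
      = ∑ j with D.eigenvalue (k j) x = μ, δ j ∧
    ((∀ i : Fin N, D.eigenvalue (i + 1) x = μ →
        ∑ j with (if 0 ≤ δ j then A j else B j) = i, δ j = 0) → ∀ u : Y,
      ∑ j with D.eigenvalue (k j) x = μ, δ j * (D.B x (φ j) u ^ 2 / D.Q x (φ j)) = 0) := by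
  have htotal : ∑ i ∈ Finset.univ.filter (fun i : Fin N => D.eigenvalue (i + 1) x = μ),
        (∑ j with (if 0 ≤ δ j then A j else B j) = i, δ j)
      = ∑ j with D.eigenvalue (k j) x = μ, δ j := by
    have h1 := sum_fiber_mul δ (fun j => if 0 ≤ δ j then A j else B j)
      fun i => if D.eigenvalue (i + 1) x = μ then 1 else 0
    have h2 : ∀ j, D.eigenvalue ((if 0 ≤ δ j then A j else B j : Fin N) + 1) x
        = D.eigenvalue (k j) x := fun j => by
      split_ifs
      exacts [hA j, hB j]
    simp only [h2, mul_ite, mul_one, mul_zero, ← Finset.sum_filter] at h1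
    exact h1
  refine ⟨htotal, fun hzero u => ?_⟩
  by_cases hex : ∃ j₁, D.eigenvalue (k j₁) x = μ ∧ A j₁ = B j₁
  · obtain ⟨j₁, hj₁, hAB₁⟩ := hex
    obtain ⟨hfirst, hlast⟩ := hAB j₁ hAB₁
    obtain ⟨e, he, hspan⟩ := hD.exists_span_of_simple hY hx hfirst hlast
    rw [Finset.sum_congr rfl (g := fun j => δ j * D.B x e u ^ 2), ← Finset.sum_mul, ← htotal,
      Finset.sum_eq_zero fun i hi => hzero i (Finset.mem_filter.mp hi).2, zero_mul]
    intro j hj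
    have hjφ : φ j ∈ D.E (A j₁ + 1) x := by
      have := hφ j
      rwa [E, (Finset.mem_filter.mp hj).2, ← hj₁, ← hA j₁] at this
    obtain ⟨c, hc⟩ := hspan _ hjφ
    rw [hc, D.B_sq_div_Q_smul he (hc ▸ hφ0 j)]
  · push Not at hex
    refine Finset.sum_eq_zero fun j hj => ?_
    have hjμ := (Finset.mem_filter.mp hj).2
    have hval : ∀ {i j : Fin l} {p q : Fin N}, D.eigenvalue (p + 1) x = D.eigenvalue (k i) x →
        D.eigenvalue (q + 1) x = D.eigenvalue (k j) x → p = q →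
        D.eigenvalue (k i) x = D.eigenvalue (k j) x := by
      rintro i j p q hp hq rfl
      exact hp.symm.trans hq
    rw [weight_eq_zero (hex j hjμ) (fun j' h => hBeq _ _ (hval (hA j') (hA j) h))
      (fun j' h => hAeq _ _ (hval (hB j') (hB j) h)) (fun j' h => hAeq _ _ (hval (hB j') (hA j) h))
      (fun j' h => hBeq _ _ (hval (hA j') (hB j) h)) (hzero _ ((hA j).trans hjμ))
      (hzero _ ((hB j).trans hjμ)), zero_mul]

end RayleighFamily

/-! ### The Euler–Lagrange equation and criticality -/

theorem theorem3p13 {X Y : Type*} [NormedAddCommGroup X] [NormedSpace ℝ X] [CompleteSpace X]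
    [AddCommGroup Y] [Module ℝ Y] (hY : ¬ FiniteDimensional ℝ Y)
    (Ω : Set X) (hΩ : IsOpen Ω)
    (D : RayleighFamily X Y) (hD : D.Standing Ω)
    (sc : X → ℝ) (hsc_pos : ∀ y ∈ Ω, 0 < sc y) (hsc : ContDiffOn ℝ 1 sc Ω)
    (x : X) (hx : x ∈ Ω)
    (l : ℕ) (k : Fin l → ℕ) (hk : ∀ j, 1 ≤ k j)
    (φ : Fin l → Y) (hφ : ∀ j, φ j ∈ D.E (k j) x) (hφ0 : ∀ j, φ j ≠ 0)
    (δ : Fin l → ℝ)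
    (hEL : ∑ j, δ j • fderiv ℝ (fun y => D.rayleigh y (φ j)) x
      + ((∑ j, δ j * D.eigenvalue (k j) x) / sc x) • fderiv ℝ sc x = 0) :
    ∃ N : ℕ, 1 ≤ N ∧ ∃ dp dm : Fin N → ℝ,
      -- the coefficients only charge the two ends of a block of equal eigenvalues
      (∀ i : Fin N,
        (0 < dp i → ∀ m : ℕ, 1 ≤ m → m ≤ (i : ℕ) →
          D.eigenvalue m x < D.eigenvalue (i + 1) x) ∧
        (dp i < 0 → D.eigenvalue (i + 1) x < D.eigenvalue (i + 2) x) ∧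
        (dm i < 0 → ∀ m : ℕ, 1 ≤ m → m ≤ (i : ℕ) →
          D.eigenvalue m x < D.eigenvalue (i + 1) x) ∧
        (0 < dm i → D.eigenvalue (i + 1) x < D.eigenvalue (i + 2) x)) ∧
      -- on each eigenspace they have the total weight of the given family, and they vanish
      -- there only if the quadratic form built from that family does
      (∀ d : Fin N → ℝ, d = dp ∨ d = dm → ∀ μ : ℝ,
        ∑ i ∈ Finset.univ.filter (fun i : Fin N => D.eigenvalue (i + 1) x = μ), d i
          = ∑ j with D.eigenvalue (k j) x = μ, δ j ∧
        ((∀ i : Fin N, D.eigenvalue (i + 1) x = μ → d i = 0) → ∀ u : Y,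
          ∑ j with D.eigenvalue (k j) x = μ, δ j * (D.B x (φ j) u ^ 2 / D.Q x (φ j)) = 0)) ∧
      -- the superdifferential
      (∀ F : (Fin N → ℝ) → ℝ, ContDiff ℝ 1 F →
        (∀ i, fderiv ℝ F (fun n => sc x * D.eigenvalue (n + 1) x) (Pi.single i 1) = dp i) →
        (0 : X →L[ℝ] ℝ) ∈
          superdifferential (fun y => F (fun n => sc y * D.eigenvalue (n + 1) y)) x ∧
        IsCriticalFor (fun y => F (fun n => sc y * D.eigenvalue (n + 1) y)) x) ∧
      -- the subdifferential
      (∀ F : (Fin N → ℝ) → ℝ, ContDiff ℝ 1 F →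
        (∀ i, fderiv ℝ F (fun n => sc x * D.eigenvalue (n + 1) x) (Pi.single i 1) = dm i) →
        (0 : X →L[ℝ] ℝ) ∈
          subdifferential (fun y => F (fun n => sc y * D.eigenvalue (n + 1) y)) x ∧
        IsCriticalFor (fun y => F (fun n => sc y * D.eigenvalue (n + 1) y)) x) := by
  have hmono : ∀ p q, p ≤ q → D.eigenvalue (p + 1) x ≤ D.eigenvalue (q + 1) x :=
    fun p q hpq => hD.eigenvalue_mono hY hx hpq
  choose fst hfst hfst_lt using fun j => D.exists_first_index x (hk j) hmono
  choose lst hlst hlst_lt using fun j => hD.exists_last_index hY hx (hk j)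
  -- `N` exceeds all the indices of the ends of the blocks concerned
  set N := ∑ j, (fst j + lst j + 1) + 1 with hN
  have hle : ∀ j, fst j + lst j + 1 ≤ ∑ j, (fst j + lst j + 1) := fun j =>
    Finset.single_le_sum (f := fun j => fst j + lst j + 1) (fun _ _ => Nat.zero_le _)
      (Finset.mem_univ j)
  let A : Fin l → Fin N := fun j => ⟨fst j, by have := hle j; omega⟩
  let B : Fin l → Fin N := fun j => ⟨lst j, by have := hle j; omega⟩
  have hAeq : ∀ j j', D.eigenvalue (k j) x = D.eigenvalue (k j') x → A j = A j' := by
    intro j j' h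
    rw [← hfst j, ← hfst j'] at h
    refine Fin.ext (le_antisymm ?_ ?_)
    · exact not_lt.mp fun hlt => (hfst_lt j _ hlt).ne h.symm
    · exact not_lt.mp fun hlt => (hfst_lt j' _ hlt).ne h
  have hBeq : ∀ j j', D.eigenvalue (k j) x = D.eigenvalue (k j') x → B j = B j' := by
    have hle : ∀ j j', D.eigenvalue (lst j + 1) x = D.eigenvalue (lst j' + 1) x →
        lst j' ≤ lst j := fun j j' h => not_lt.mp fun hlt =>
      absurd ((hlst_lt j).trans_le (hmono _ _ (Nat.succ_le_of_lt hlt))) h.not_lt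
    intro j j' h
    rw [← hlst j, ← hlst j'] at h
    exact Fin.ext (le_antisymm (hle _ _ h.symm) (hle _ _ h))
  have hfirst : ∀ j m, 1 ≤ m → m ≤ fst j → D.eigenvalue m x < D.eigenvalue (fst j + 1) x := by
    intro j m hm hmj
    obtain ⟨i, rfl⟩ : ∃ i, m = i + 1 := ⟨m - 1, by omega⟩
    exact hfst_lt j i hmj
  have hscd : DifferentiableAt ℝ sc x :=
    (hsc.contDiffAt (hΩ.mem_nhds hx)).differentiableAt one_ne_zero
  -- the right derivatives at both ends of the blocks, compared with the Rayleigh quotients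
  have hEfst : ∀ j, φ j ∈ D.E (fst j + 1) x := fun j => by
    have := hφ j
    rwa [RayleighFamily.E, ← hfst j] at this
  have hElst : ∀ j, φ j ∈ D.E (lst j + 1) x := fun j => by
    have := hφ j
    rwa [RayleighFamily.E, ← hlst j] at this
  have hderA : ∀ (h : X) j, ∃ m, HasRightDirDeriv (D.eigenvalue (A j + 1)) x h m ∧
      m ≤ fderiv ℝ (fun y => D.rayleigh y (φ j)) x h := fun h j => by
    obtain ⟨m, hm, hmu⟩ := (hD.eigenvalue_ray hΩ hY hx h (fst j)).2.1 (hfst_lt j)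
    exact ⟨m, hm, hmu _ (hEfst j) (hφ0 j)⟩
  have hderB : ∀ (h : X) j, ∃ m, HasRightDirDeriv (D.eigenvalue (B j + 1)) x h m ∧
      fderiv ℝ (fun y => D.rayleigh y (φ j)) x h ≤ m := fun h j => by
    obtain ⟨m, hm, hmu⟩ := (hD.eigenvalue_ray hΩ hY hx h (lst j)).2.2 (hlst_lt j)
    exact ⟨m, hm, hmu _ (hElst j) (hφ0 j)⟩
  refine ⟨N, Nat.le_add_left _ _, fun i => ∑ j with (if 0 ≤ δ j then A j else B j) = i, δ j,
    fun i => ∑ j with (if 0 ≤ δ j then B j else A j) = i, δ j, fun i => ⟨?_, ?_, ?_, ?_⟩, ?_, ?_, ?_⟩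
  · intro hi
    obtain ⟨j, rfl⟩ := exists_of_weight_pos hi
    exact hfirst j
  · intro hi
    obtain ⟨j, rfl⟩ := exists_of_weight_neg hi
    exact hlst_lt j
  · intro hi
    obtain ⟨j, rfl⟩ := exists_of_weight_neg hi
    exact hfirst j
  · intro hi
    obtain ⟨j, rfl⟩ := exists_of_weight_pos hi
    exact hlst_lt j
  · have hsimple : ∀ j, A j = B j →
        (∀ i < fst j, D.eigenvalue (i + 1) x < D.eigenvalue (fst j + 1) x) ∧
        D.eigenvalue (fst j + 1) x < D.eigenvalue (fst j + 2) x := fun j h => by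
      have h1 : fst j = lst j := congrArg Fin.val h
      exact ⟨hfst_lt j, by rw [h1]; exact hlst_lt j⟩
    rintro d (rfl | rfl) μ
    · exact hD.weights_on_block hY hx hφ hφ0 hfst hlst hAeq hBeq hsimple μ
    · refine hD.weights_on_block hY hx hφ hφ0 hlst hfst hBeq hAeq (fun j h => ?_) μ
      rw [h]
      exact hsimple j h.symm
  · intro F hF hd
    suffices hsup : (0 : X →L[ℝ] ℝ) ∈
        superdifferential (fun y => F (fun n => sc y * D.eigenvalue (n + 1) y)) x from
      ⟨hsup, Or.inr (zero_mem_clarkeSuperdifferential hsup)⟩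
    intro h
    have hex : ∀ j, ∃ m, HasRightDirDeriv
        (D.eigenvalue ((if 0 ≤ δ j then A j else B j : Fin N) + 1)) x h m ∧
        δ j * (m - fderiv ℝ (fun y => D.rayleigh y (φ j)) x h) ≤ 0 := by
      intro j
      split_ifs with hj
      · obtain ⟨m, hm, hle⟩ := hderA h j
        exact ⟨m, hm, mul_nonpos_of_nonneg_of_nonpos hj (sub_nonpos.mpr hle)⟩
      · obtain ⟨m, hm, hle⟩ := hderB h j
        exact ⟨m, hm, mul_nonpos_of_nonpos_of_nonneg (not_le.mp hj).le (sub_nonneg.mpr hle)⟩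
    choose m hm hmle using hex
    refine ⟨_, hD.hasRightDirDeriv_comp_eigenvalue hY hΩ hx (hsc_pos x hx) hscd hEL
      (fun j => ?_) hm hF hd, ?_⟩
    · split_ifs
      exacts [hfst j, hlst j]
    · exact mul_nonpos_of_nonneg_of_nonpos (hsc_pos x hx).le
        (Finset.sum_nonpos fun j _ => hmle j)
  · intro F hF hd
    suffices hsub : (0 : X →L[ℝ] ℝ) ∈
        subdifferential (fun y => F (fun n => sc y * D.eigenvalue (n + 1) y)) x from
      ⟨hsub, Or.inl (zero_mem_clarkeSubdifferential hsub)⟩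
    intro h
    have hex : ∀ j, ∃ m, HasRightDirDeriv
        (D.eigenvalue ((if 0 ≤ δ j then B j else A j : Fin N) + 1)) x h m ∧
        0 ≤ δ j * (m - fderiv ℝ (fun y => D.rayleigh y (φ j)) x h) := by
      intro j
      split_ifs with hj
      · obtain ⟨m, hm, hle⟩ := hderB h j
        exact ⟨m, hm, mul_nonneg hj (sub_nonneg.mpr hle)⟩
      · obtain ⟨m, hm, hle⟩ := hderA h j
        exact ⟨m, hm, mul_nonneg_of_nonpos_of_nonpos (not_le.mp hj).le (sub_nonpos.mpr hle)⟩
    choose m hm hmle using hex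
    refine ⟨_, hD.hasRightDirDeriv_comp_eigenvalue hY hΩ hx (hsc_pos x hx) hscd hEL
      (fun j => ?_) hm hF hd, ?_⟩
    · split_ifs
      exacts [hlst j, hfst j]
    · exact mul_nonneg (hsc_pos x hx).le (Finset.sum_nonneg fun j _ => hmle j)
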